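/- For real numbers $\omega_1,\dots,\omega_r>0$ put $\boldsymbol\omega=(\omega_1,\dots,\omega_r)$ and, for $x\in\mathbb C$ not of the form $-(n_1\omega_1+\cdots+n_r\omega_r)$ with integers $n_i\ge 0$, let $$\zeta_r(w,x,\boldsymbol\omega)=\sum_{n_1,\dots,n_r\ge 0}(n_1\omega_1+\cdots+n_r\omega_r+x)^{-w}$$ (principal powers, $\operatorname{Re} w>r$, continued meromorphically in $w$), $\Gamma_r(x,\boldsymbol\omega)=\exp\bigl(\partial_w\zeta_r(w,x,\boldsymbol\omega)|_{w=0}\bigr)$ and $S_r(x,\boldsymbol\omega)=\Gamma_r(x,\boldsymbol\omega)^{-1}\,\Gamma_r(\omega_1+\cdots+\omega_r-x,\boldsymbol\omega)^{(-1)^r}$. For $f:\mathbb R\to\mathbb C\cup\{\infty\}$ let $$Z_f(w,s)=\frac1{\Gamma(w)}\int_1^\infty f(x)\,x^{-s-1}(\log x)^{w-1}\,dx$$ (continued meromorphically in $w$) and $\zeta_f(s)=\exp\bigl(\partial_w Z_f(w,s)|_{w=0}\bigr)$ (continued meromorphically in $s$). The function $f$ is an absolute automorphic form of weight $D\in\mathbb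 Z$ if $f(1/x)=C\,x^{-D}f(x)$ for all real $x\neq 0$, with a constant $C\in\{1,-1\}$. The 3-state Grover walk on the cycle $C_3$ acts on $\mathbb C^3\otimes\mathbb C^3$, with basis $|x\rangle\otimes|c\rangle$, $x\in\mathbb Z/3$, $c\in\{\leftarrow,\cdot,\rightarrow\}$, by $U=S\,(I\otimes A)$, where $S(|x\rangle\otimes|c\rangle)=|x+\epsilon_c\rangle\otimes|c\rangle$ with $\epsilon_\leftarrow=-1$, $\epsilon_\cdot=0$, $\epsilon_\rightarrow=1$, and where the local coin is $$A^{M}=\frac13\begin{bmatrix}-1&2&2\\2&-1&2\\2&2&-1\end{bmatrix}\ (\text{M type}),\qquad A^{F}=\frac13\begin{bmatrix}2&2&-1\\2&-1&2\\-1&2&2\end{bmatrix}\ (\text{F type}).$$ Let $\zeta^{M}(u)$ and $\zeta^{F}(u)$ be the corresponding zeta functions $\det(I-uU)^{-1}\in\mathbb C\cup\{\infty\}$. **Theorem.** One has $$\zeta^{M}(u)=-\frac{u-1}{(u^2-1)^2(u^3-1)^2},\qquad \zeta^{F}(u)=\frac{u-1}{(u^2-1)(u^4-1)^2},$$ with value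 $\infty$ exactly where the displayed denominator vanishes, and both are absolute automorphic forms of weight $-9$ on $\mathbb R$. In the formulas below, the functions $\zeta_4(\cdot,x,(2,2,3,3))$ and $\zeta_3(\cdot,x,(2,4,4))$ exist as meromorphic functions on $\mathbb C$, regular at $w=0$. For $\operatorname{Re}s>-9$, the integral defining $Z_{\zeta^M}(w,s)$ converges absolutely for $\operatorname{Re}w>3$, the one defining $Z_{\zeta^F}(w,s)$ converges absolutely for $\operatorname{Re}w>2$, and both functions continue meromorphically to $w\in\mathbb C$ and are regular at $w=0$. The functions $\zeta_{\zeta^M}(s)$ and $\zeta_{\zeta^F}(s)$, given for $\operatorname{Re}s>-9$ by the defining formula, continue meromorphically to $s\in\mathbb C$. Moreover: *M type.* For $\operatorname{Re}s>-9$ and $w\notin\{1,2,3,4\}$, $$Z_{\zeta^{M}}(w,s)=-\sum_{I\subset\{1\}}(-1)^{|I|}\,\zeta_4\bigl(w,s+9+|I|,(2,2,3,3)\bigr),$$ and for all $s\in\mathbb C$ for which no argument of $\Gamma_4$ involved is a pole $-(2n_1+2n_2+3n_3+3n_4)$, $n_i\ge 0$ (the arguments being $s+9,s+10$ in the first formula,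 and also $-s,1-s$ in the second), $$\zeta_{\zeta^{M}}(s)=\prod_{I\subset\{1\}}\Gamma_4\bigl(s+9+|I|,(2,2,3,3)\bigr)^{(-1)^{|I|+1}},$$ $$\zeta_{\zeta^{M}}(-9-s)^{-1}=\Bigl(\prod_{I\subset\{1\}}S_4\bigl(s+9+|I|,(2,2,3,3)\bigr)^{(-1)^{|I|+1}}\Bigr)\,\zeta_{\zeta^{M}}(s).$$ *F type.* For $\operatorname{Re}s>-9$ and $w\notin\{1,2,3\}$, $$Z_{\zeta^{F}}(w,s)=\sum_{I\subset\{1\}}(-1)^{|I|}\,\zeta_3\bigl(w,s+9+|I|,(2,4,4)\bigr),$$ and for all $s\in\mathbb C$ for which no argument of $\Gamma_3$ involved (the same arguments as above) is a pole $-(2n_1+4n_2+4n_3)$, $n_i\ge 0$, $$\zeta_{\zeta^{F}}(s)=\prod_{I\subset\{1\}}\Gamma_3\bigl(s+9+|I|,(2,4,4)\bigr)^{(-1)^{|I|}},$$ $$\zeta_{\zeta^{F}}(-9-s)=\Bigl(\prod_{I\subset\{1\}}S_3\bigl(s+9+|I|,(2,4,4)\bigr)^{(-1)^{|I|}}\Bigr)\,\zeta_{\zeta^{F}}(s).$$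 -/

import Mathlib

open MeasureTheory
open scoped Kronecker

namespace AbsZeta

noncomputable section

/-! ### Three-state quantum walks on the cycle `C_N` and their zeta functions

The standard basis of the state space is `|x⟩ ⊗ |c⟩`, with `x : ZMod N` the position and `c : Fin 3`
the chirality, `0, 1, 2` being `←`, `·`, `→` in this order. -/

/-- The displacement of a chirality: `←` moves by `-1`, `·` stays, `→` moves by `+1`. -/
def step (N : ℕ) : Fin 3 → ZMod N := ![-1, 0, 1]

/-- The shift operator: `S (|x⟩ ⊗ |c⟩) = |x + step c⟩ ⊗ |c⟩`, as a matrix (row = image). -/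
def shiftOp (N : ℕ) : Matrix (ZMod N × Fin 3) (ZMod N × Fin 3) ℂ :=
  Matrix.of fun p q => if p = (q.1 + step N q.2, q.2) then 1 else 0

/-- The coin operator `C = ∑ x, |x⟩⟨x| ⊗ A`. -/
def coinOp (N : ℕ) (A : Matrix (Fin 3) (Fin 3) ℂ) :
    Matrix (ZMod N × Fin 3) (ZMod N × Fin 3) ℂ :=
  (1 : Matrix (ZMod N) (ZMod N) ℂ) ⊗ₖ A

/-- The time-evolution operator `U = S C` of the walk on `C_N` with local coin `A`. -/
def evolutionOp (N : ℕ) [NeZero N] (A : Matrix (Fin 3) (Fin 3) ℂ) :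
    Matrix (ZMod N × Fin 3) (ZMod N × Fin 3) ℂ :=
  shiftOp N * coinOp N A

/-- The local coin operator of the M-type Grover walk with 3 states. -/
def groverCoinM : Matrix (Fin 3) (Fin 3) ℂ :=
  (1 / 3 : ℂ) • !![-1, 2, 2; 2, -1, 2; 2, 2, -1]

/-- The local coin operator of the F-type Grover walk with 3 states. -/
def groverCoinF : Matrix (Fin 3) (Fin 3) ℂ :=
  (1 / 3 : ℂ) • !![2, 2, -1; 2, -1, 2; -1, 2, 2]

open Classical in
/-- The zeta function `u ↦ det (I - u U)⁻¹` of the walk, with values in `ℂ ∪ {∞}`. -/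
def walkZeta (N : ℕ) [NeZero N] (A : Matrix (Fin 3) (Fin 3) ℂ) (u : ℂ) : OnePoint ℂ :=
  if (1 - u • evolutionOp N A).det = 0 then OnePoint.infty
  else (((1 - u • evolutionOp N A).det⁻¹ : ℂ) : OnePoint ℂ)

/-- The zeta function of the M-type Grover walk with 3 states on `C_3`, on the real line. -/
def groverZetaM : ℝ → OnePoint ℂ := fun x => walkZeta 3 groverCoinM (x : ℂ)

/-- The zeta function of the F-type Grover walk with 3 states on `C_3`, on the real line. -/
def groverZetaF : ℝ → OnePoint ℂ := fun x => walkZeta 3 groverCoinF (x : ℂ)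

/-! ### Absolute automorphic forms -/

/-- `f(1/x) = C x^(-D) f(x)` in `ℂ ∪ {∞}` for all real `x ≠ 0`, with a constant `C = 1` or `C = -1`;
multiplication by the nonzero number `C x^(-D)` fixes `∞`. -/
def IsAbsoluteAutomorphicForm (f : ℝ → OnePoint ℂ) (D : ℤ) : Prop :=
  ∃ C : ℂ, (C = 1 ∨ C = -1) ∧
    ∀ x : ℝ, x ≠ 0 → f (1 / x) = OnePoint.map (fun z : ℂ => C * (x : ℂ) ^ (-D) * z) (f x)

/-! ### Meromorphic continuation from a right half-plane -/

/-- `G` is meromorphic on `ℂ` (with the value `0` at its poles and the correct value at all other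
points), and on the half-plane `σ < re z` the defining expression `g z` makes sense (`P z`) and is
equal to `G z`. -/
structure IsContinuationFrom (σ : ℝ) (P : ℂ → Prop) (g G : ℂ → ℂ) : Prop where
  meromorphic : MeromorphicNFOn G Set.univ
  eq_of_lt_re : ∀ z : ℂ, σ < z.re → P z ∧ G z = g z

/-- The meromorphic continuation to `ℂ` of a function `g` given on some right half-plane (an
arbitrary function if there is none; it is unique by the identity theorem if there is one). -/
def continuation (P : ℂ → Prop) (g : ℂ → ℂ) : ℂ → ℂ :=
  Classical.epsilon fun G => ∃ σ : ℝ, IsContinuationFrom σ P g G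

/-! ### Multiple Hurwitz zeta, multiple gamma and multiple sine functions -/

/-- `n₁ ω₁ + ⋯ + n_r ω_r + x`. -/
def linForm {r : ℕ} (ω : Fin r → ℝ) (x : ℂ) (n : Fin r → ℕ) : ℂ :=
  (∑ i, (n i : ℂ) * (ω i : ℂ)) + x

/-- The terms of the series defining `ζ_r(s, x, ω)` form a summable family. -/
def MultHurwitzConverges {r : ℕ} (ω : Fin r → ℝ) (x s : ℂ) : Prop :=
  Summable fun n : Fin r → ℕ => linForm ω x n ^ (-s)

/-- The series `∑ (n₁ ω₁ + ⋯ + n_r ω_r + x)^(-s)`, with principal powers. -/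
def multHurwitzSeries {r : ℕ} (ω : Fin r → ℝ) (x s : ℂ) : ℂ :=
  ∑' n : Fin r → ℕ, linForm ω x n ^ (-s)

/-- The multiple Hurwitz zeta function `ζ_r(s, x, ω)`, continued meromorphically in `s`. -/
def multHurwitz {r : ℕ} (s x : ℂ) (ω : Fin r → ℝ) : ℂ :=
  continuation (MultHurwitzConverges ω x) (multHurwitzSeries ω x) s

/-- The multiple gamma function `Γ_r(x, ω) = exp (∂/∂s ζ_r(s, x, ω) at s = 0)`. -/
def multGamma {r : ℕ} (x : ℂ) (ω : Fin r → ℝ) : ℂ :=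
  Complex.exp (deriv (fun s : ℂ => multHurwitz s x ω) 0)

/-- The multiple sine function `S_r(x, ω) = Γ_r(x, ω)⁻¹ Γ_r(ω₁ + ⋯ + ω_r - x, ω)^((-1)^r)`. -/
def multSine {r : ℕ} (x : ℂ) (ω : Fin r → ℝ) : ℂ :=
  (multGamma x ω)⁻¹ * multGamma ((∑ i, (ω i : ℂ)) - x) ω ^ ((-1 : ℤ) ^ r)

/-- The points `x = -(n₁ ω₁ + ⋯ + n_r ω_r)`, where `Γ_r(·, ω)` has its poles. -/
def IsGammaPole {r : ℕ} (ω : Fin r → ℝ) (x : ℂ) : Prop :=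
  ∃ n : Fin r → ℕ, linForm ω x n = 0

/-! ### Absolute Hurwitz zeta functions and absolute zeta functions -/

/-- The complex value of a point of `ℂ ∪ {∞}`; the point `∞` (met only on a null set in the
integrals below) is sent to `0`. -/
def finiteValue (z : OnePoint ℂ) : ℂ := z.elim 0 id

/-- The integrand `f(x) x^(-s-1) (log x)^(w-1)`. -/
def absHurwitzIntegrand (f : ℝ → OnePoint ℂ) (w s : ℂ) (x : ℝ) : ℂ :=
  finiteValue (f x) * (x : ℂ) ^ (-s - 1) * (Real.log x : ℂ) ^ (w - 1)

/-- The integral of `f(x) x^(-s-1) (log x)^(w-1)` over `(1, ∞)` converges absolutely. -/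
def AbsHurwitzConverges (f : ℝ → OnePoint ℂ) (s w : ℂ) : Prop :=
  (∀ᵐ x ∂(volume.restrict (Set.Ioi (1 : ℝ))), f x ≠ OnePoint.infty) ∧
    IntegrableOn (absHurwitzIntegrand f w s) (Set.Ioi 1)

/-- `Γ(w)⁻¹` times the integral of `f(x) x^(-s-1) (log x)^(w-1)` over `(1, ∞)`. -/
def absHurwitzIntegral (f : ℝ → OnePoint ℂ) (s w : ℂ) : ℂ :=
  1 / Complex.Gamma w * ∫ x in Set.Ioi (1 : ℝ), absHurwitzIntegrand f w s x

/-- The absolute Hurwitz zeta function `Z_f(w, s)`, continued meromorphically in `w`. -/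
def absHurwitz (f : ℝ → OnePoint ℂ) (w s : ℂ) : ℂ :=
  continuation (AbsHurwitzConverges f s) (absHurwitzIntegral f s) w

/-- `Z_f(w, s)` exists as a meromorphic function of `w`, and it is regular at `w = 0`. -/
def AbsZetaDefined (f : ℝ → OnePoint ℂ) (s : ℂ) : Prop :=
  (∃ σ : ℝ, IsContinuationFrom σ (AbsHurwitzConverges f s) (absHurwitzIntegral f s)
      (fun w => absHurwitz f w s)) ∧
    AnalyticAt ℂ (fun w => absHurwitz f w s) 0

/-- `exp (∂/∂w Z_f(w, s) at w = 0)`. -/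
def absZetaExp (f : ℝ → OnePoint ℂ) (s : ℂ) : ℂ :=
  Complex.exp (deriv (fun w : ℂ => absHurwitz f w s) 0)

/-- The absolute zeta function `ζ_f(s) = exp (∂/∂w Z_f(w, s) at w = 0)`, continued meromorphically
in `s`. -/
def absZeta (f : ℝ → OnePoint ℂ) (s : ℂ) : ℂ :=
  continuation (AbsZetaDefined f) (absZetaExp f) s

end

end AbsZeta

open AbsZeta

/-!
The zeta functions of the two walks are computed in the Fourier basis of `ℤ / 3`, where the
evolution operator is block diagonal with three `3 × 3` blocks (`det_one_sub_smul_evolutionOp`).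
The resulting determinants are palindromic up to sign, which is the automorphy.

With `x = e ^ t` the integral defining `Z_f(w, s)` is the Mellin transform of
`h(t) e ^ (-(s + 9) t)`, where `h(t) = ± (1 - e ^ (-t)) ∏ 1 / (1 - e ^ (-ω_i t))`
(`absHurwitz_eq_mellin`, `groverZetaM_exp`, `groverZetaF_exp`), and the multiple Hurwitz zeta function
is the Mellin transform of `e ^ (-x t) ∏ 1 / (1 - e ^ (-ω_i t))` for `re x > 0`. So everything rests
on one statement, `HasPoleExpansion.exists_entire`: if `h` is bounded at infinity and has at most a
pole of order `r` at `0`, then `Γ(w)⁻¹ ∫ h(t) e ^ (-y t) t ^ (w - 1) dt` is an entire function of `w`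
divided by `(w - 1) ⋯ (w - r)`. It is proved by integrating the first `K` terms of the Laurent
expansion of `h` in closed form. Moreover the derivative at `w = 0` is holomorphic in `y`, because
`1 / Γ` has a simple zero at `0`, so that the remainder contributes a Laplace transform.

For `re x ≤ 0` finitely many terms of the Dirichlet series are split off, and the others are treated
as before (`exists_entire_dirichlet`). Their contribution to the exponential of the derivative at
`w = 0` is a product of factors `(n₁ ω₁ + ⋯ + n_r ω_r + x)⁻¹`, whatever the branch of the logarithm, so
`Γ_r(x, ω)` is meromorphic in `x` and holomorphic off its poles (`meromorphicAt_multGamma`,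
`analyticAt_multGamma`). Hence `(Γ_n(s + 9, ω) / Γ_n(s + 10, ω)) ^ (± 1)` is the meromorphic
continuation of the absolute zeta function (`absZeta_continuation`), and the functional equation
follows by expanding the definition of the multiple sine function.
-/

/-! ### Meromorphic continuation from a half-plane -/

namespace AbsZeta

open Filter Topology

/-- Identity theorem: meromorphic functions in normal form on `ℂ` which agree on a right half-plane
are equal. -/
lemma eq_of_meromorphicNFOn_of_eq_halfPlane {G₁ G₂ : ℂ → ℂ} (h₁ : MeromorphicNFOn G₁ Set.univ)
    (h₂ : MeromorphicNFOn G₂ Set.univ) (σ : ℝ) (h : ∀ z : ℂ, σ < z.re → G₁ z = G₂ z) :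
    G₁ = G₂ := by
  have hm : MeromorphicOn (G₁ - G₂) Set.univ := fun x hx =>
    ((h₁ hx).meromorphicAt).sub (h₂ hx).meromorphicAt
  have hopen : IsOpen {z : ℂ | σ < z.re} := isOpen_lt continuous_const Complex.continuous_re
  have htop : meromorphicOrderAt (G₁ - G₂) ((σ + 1 : ℝ) : ℂ) = ⊤ := by
    rw [meromorphicOrderAt_eq_top_iff]
    have : {z : ℂ | σ < z.re} ∈ 𝓝 ((σ + 1 : ℝ) : ℂ) := hopen.mem_nhds (by simp)
    filter_upwards [mem_nhdsWithin_of_mem_nhds this] with z hz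
    simp [h z hz]
  funext x
  have hx : meromorphicOrderAt (G₁ - G₂) x = ⊤ := by
    by_contra hne
    exact hm.meromorphicOrderAt_ne_top_of_isPreconnected isPreconnected_univ
      (Set.mem_univ x) (Set.mem_univ _) hne htop
  rw [meromorphicOrderAt_eq_top_iff] at hx
  have hev : G₁ =ᶠ[𝓝[≠] x] G₂ := by
    filter_upwards [hx] with z hz
    simpa [sub_eq_zero] using hz
  exact (((h₁ (Set.mem_univ x)).eventuallyEq_nhdsNE_iff_eventuallyEq_nhds
    (h₂ (Set.mem_univ x))).1 hev).eq_of_nhds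

lemma IsContinuationFrom.continuation_eq {σ : ℝ} {P : ℂ → Prop} {g G : ℂ → ℂ}
    (h : IsContinuationFrom σ P g G) : continuation P g = G := by
  obtain ⟨τ, hτ⟩ : ∃ τ : ℝ, IsContinuationFrom τ P g (continuation P g) :=
    Classical.epsilon_spec (p := fun G => ∃ σ : ℝ, IsContinuationFrom σ P g G) ⟨G, σ, h⟩
  refine eq_of_meromorphicNFOn_of_eq_halfPlane hτ.meromorphic h.meromorphic (max σ τ) fun z hz => ?_
  rw [(hτ.eq_of_lt_re z ((le_max_right _ _).trans_lt hz)).2,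
    (h.eq_of_lt_re z ((le_max_left _ _).trans_lt hz)).2]

/-- If a meromorphic function `F` is analytic, and equal to the defining expression, on a right
half-plane, then the continuation is the normal form of `F`; so it agrees with `F` wherever `F` is
analytic. -/
lemma isContinuationFrom_continuation {σ : ℝ} {P : ℂ → Prop} {g F : ℂ → ℂ}
    (hF : MeromorphicOn F Set.univ)
    (h : ∀ z : ℂ, σ < z.re → AnalyticAt ℂ F z ∧ P z ∧ F z = g z) :
    IsContinuationFrom σ P g (continuation P g) ∧
      ∀ z, AnalyticAt ℂ F z → continuation P g =ᶠ[𝓝 z] F := by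
  have heq : ∀ z, AnalyticAt ℂ F z → toMeromorphicNFOn F Set.univ z = F z := fun z hz => by
    rw [toMeromorphicNFOn_eq_toMeromorphicNFAt hF (Set.mem_univ z),
      toMeromorphicNFAt_eq_self.2 hz.meromorphicNFAt]
  have hc : IsContinuationFrom σ P g (toMeromorphicNFOn F Set.univ) :=
    ⟨meromorphicNFOn_toMeromorphicNFOn F Set.univ, fun z hz =>
      ⟨(h z hz).2.1, (heq z (h z hz).1).trans (h z hz).2.2⟩⟩
  rw [hc.continuation_eq]
  exact ⟨hc, fun z hz => hz.eventually_analyticAt.mono heq⟩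

/-- The rising product `z (z + 1) ⋯ (z + k - 1)`. -/
noncomputable def risingProd (z : ℂ) (k : ℕ) : ℂ := ∏ j ∈ Finset.range k, (z + j)

lemma risingProd_add (z : ℂ) (k l : ℕ) :
    risingProd z (k + l) = risingProd z k * risingProd (z + k) l := by
  simp only [risingProd, Finset.prod_range_add, Nat.cast_add, add_assoc]

lemma differentiable_risingProd (k : ℕ) : Differentiable ℂ fun z => risingProd z k := by
  unfold risingProd
  fun_prop

lemma Gamma_inv_eq_risingProd_mul (z : ℂ) (k : ℕ) :
    (Complex.Gamma z)⁻¹ = risingProd z k * (Complex.Gamma (z + k))⁻¹ := by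
  induction k with
  | zero => simp [risingProd]
  | succ k ih =>
    rw [ih, risingProd_add, mul_assoc, Complex.one_div_Gamma_eq_self_mul_one_div_Gamma_add_one]
    simp [risingProd, add_assoc]

/-- The polynomial `(w - 1) (w - 2) ⋯ (w - r)`. -/
noncomputable def polePoly (r : ℕ) (w : ℂ) : ℂ := risingProd (w - r) r

lemma polePoly_ne_zero {r : ℕ} {w : ℂ} (h : ∀ j : ℕ, 1 ≤ j → j ≤ r → w ≠ j) :
    polePoly r w ≠ 0 := by
  unfold polePoly risingProd
  refine Finset.prod_ne_zero_iff.2 fun j hj h0 => ?_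
  have hjr := Finset.mem_range.1 hj
  apply h (r - j) (by omega) (by omega)
  rw [Nat.cast_sub hjr.le]
  linear_combination h0

lemma polePoly_ne_zero_of_lt_re {r : ℕ} {w : ℂ} (h : r < w.re) : polePoly r w ≠ 0 := by
  refine polePoly_ne_zero fun j _ hj hw => ?_
  rw [hw, Complex.natCast_re] at h
  exact absurd hj (not_le.2 (by exact_mod_cast h))

lemma polePoly_zero_ne_zero (r : ℕ) : polePoly r 0 ≠ 0 := by
  refine polePoly_ne_zero fun j hj _ h => ?_
  have : j = 0 := by exact_mod_cast h.symm
  omega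

lemma differentiable_polePoly (r : ℕ) : Differentiable ℂ (polePoly r) := by
  unfold polePoly
  exact (differentiable_risingProd r).comp (differentiable_id.sub_const _)

lemma analyticAt_div_polePoly {E : ℂ → ℂ} (hE : Differentiable ℂ E) {r : ℕ} {z : ℂ}
    (hz : polePoly r z ≠ 0) : AnalyticAt ℂ (fun w => E w / polePoly r w) z :=
  (hE.analyticAt z).div ((differentiable_polePoly r).analyticAt z) hz

/-- If the defining expression is `E w / ((w - 1) ⋯ (w - r))` for `re w > r`, with `E` entire, then
the continuation exists and is given by this quotient off `{1, …, r}`. -/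
lemma isContinuationFrom_of_entire {r : ℕ} {P : ℂ → Prop} {g E : ℂ → ℂ} (hE : Differentiable ℂ E)
    (h : ∀ z : ℂ, r < z.re → P z ∧ g z = E z / polePoly r z) :
    IsContinuationFrom r P g (continuation P g) ∧
      ∀ z, polePoly r z ≠ 0 → continuation P g =ᶠ[𝓝 z] fun w => E w / polePoly r w := by
  have := isContinuationFrom_continuation (σ := r) (P := P) (g := g)
    (F := fun w => E w / polePoly r w)
    (fun z _ => (hE.analyticAt z).meromorphicAt.div
      ((differentiable_polePoly r).analyticAt z).meromorphicAt)
    (fun z hz => ⟨analyticAt_div_polePoly hE (polePoly_ne_zero_of_lt_re hz), (h z hz).1,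
      (h z hz).2.symm⟩)
  exact ⟨this.1, fun z hz => this.2 z (analyticAt_div_polePoly hE hz)⟩

/-! ### Mellin transforms of functions with a pole at the origin -/

open Filter Topology Set Asymptotics

/-- `h` is continuous on `(0, ∞)`, bounded at `∞`, and at `0⁺` has at most a pole of order `r`, in
the sense that `t ^ r * h t` extends to a real-analytic function at `0`. -/
structure HasPoleExpansion (h : ℝ → ℂ) (r : ℕ) : Prop where
  continuousOn : ContinuousOn h (Ioi 0)
  bounded : h =O[atTop] fun _ => (1 : ℝ)
  analytic : ∃ φ : ℝ → ℂ, AnalyticAt ℝ φ 0 ∧ ∀ᶠ t : ℝ in 𝓝[>] 0, (t : ℂ) ^ r * h t = φ t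

/-- The remainder of `h` after removing the first `K` terms `a k * t ^ (k - r)`. -/
noncomputable def laurentRem (h : ℝ → ℂ) (a : ℕ → ℂ) (r K : ℕ) (t : ℝ) : ℂ :=
  h t - ∑ k ∈ Finset.range K, a k * (t : ℂ) ^ ((k : ℤ) - (r : ℤ))

lemma HasPoleExpansion.exists_coeff {h : ℝ → ℂ} {r : ℕ} (hh : HasPoleExpansion h r) :
    ∃ a : ℕ → ℂ, ∀ K : ℕ,
      laurentRem h a r K =O[𝓝[>] 0] fun t : ℝ => t ^ (-((r : ℝ) - K)) := by
  obtain ⟨φ, ⟨p, hp⟩, hφ⟩ := hh.analytic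
  refine ⟨p.coeff, fun K => ?_⟩
  have h1 := (hp.isBigO_sub_partialSum_pow K).mono (nhdsWithin_le_nhds (s := Ioi 0))
  have h2 : (fun t : ℝ => ((t : ℂ) ^ r)⁻¹) =O[𝓝[>] 0] fun t : ℝ => (t ^ r)⁻¹ :=
    isBigO_of_le _ fun t => by simp
  refine (h2.mul h1).congr' ?_ ?_
  · filter_upwards [hφ, self_mem_nhdsWithin] with t ht (h0 : 0 < t)
    have h0' : (t : ℂ) ≠ 0 := by exact_mod_cast h0.ne'
    rw [zero_add, ← ht, mul_sub, inv_mul_cancel_left₀ (pow_ne_zero _ h0'), laurentRem,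
      FormalMultilinearSeries.partialSum, Finset.mul_sum]
    congr 1
    refine Finset.sum_congr rfl fun k _ => ?_
    rw [FormalMultilinearSeries.apply_eq_pow_smul_coeff, zpow_sub₀ h0', Complex.real_smul]
    push_cast [zpow_natCast]
    field_simp
  · filter_upwards [self_mem_nhdsWithin] with t (h0 : 0 < t)
    rw [neg_sub, Real.rpow_sub h0, Real.rpow_natCast, Real.rpow_natCast, Real.norm_of_nonneg h0.le]
    field_simp

lemma continuousOn_zpow_ofReal (n : ℤ) : ContinuousOn (fun t : ℝ => (t : ℂ) ^ n) (Ioi 0) :=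
  fun t (ht : 0 < t) => ((Complex.continuous_ofReal.continuousAt).zpow₀ n
    (Or.inl (by exact_mod_cast ht.ne'))).continuousWithinAt

lemma continuousOn_laurentRem {h : ℝ → ℂ} {r : ℕ} (hh : HasPoleExpansion h r) (a : ℕ → ℂ) (K : ℕ) :
    ContinuousOn (laurentRem h a r K) (Ioi 0) :=
  hh.continuousOn.sub (continuousOn_finsetSum _ fun _ _ =>
    continuousOn_const.mul (continuousOn_zpow_ofReal _))

lemma laurentRem_isBigO_atTop {h : ℝ → ℂ} {r : ℕ} (hh : HasPoleExpansion h r) (a : ℕ → ℂ) (K : ℕ) :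
    laurentRem h a r K =O[atTop] fun t : ℝ => t ^ K := by
  have h1 : (fun _ => (1 : ℝ)) =O[atTop] fun t : ℝ => t ^ K := by
    refine IsBigO.of_bound 1 ?_
    filter_upwards [eventually_ge_atTop 1] with t ht
    simpa using (one_le_pow₀ ht : 1 ≤ t ^ K).trans (le_abs_self _)
  refine (hh.bounded.trans h1).sub (IsBigO.fun_sum fun k hk => ?_)
  refine IsBigO.of_bound ‖a k‖ ?_
  filter_upwards [eventually_ge_atTop 1] with t ht
  have h0 : 0 < t := by linarith
  rw [norm_mul, norm_zpow, Complex.norm_real, Real.norm_of_nonneg h0.le,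
    Real.norm_of_nonneg (by positivity)]
  gcongr
  rw [← zpow_natCast]
  exact zpow_le_zpow_right₀ ht (by have := Finset.mem_range.1 hk; omega)

lemma isBigO_mul_cexp_neg {f : ℝ → ℂ} {K : ℕ} (hf : f =O[atTop] fun t : ℝ => t ^ K) {y : ℂ}
    (hy : 0 < y.re) :
    (fun t : ℝ => f t * Complex.exp (-(y * t))) =O[atTop] fun t => Real.exp (-(y.re / 2) * t) := by
  have h1 : (fun t : ℝ => t ^ K) =O[atTop] fun t => Real.exp (y.re / 2 * t) :=
    (isLittleO_pow_exp_pos_mul_atTop K (half_pos hy)).isBigO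
  have h2 : (fun t : ℝ => Complex.exp (-(y * t))) =O[atTop] fun t => Real.exp (-y.re * t) :=
    isBigO_of_le _ fun t => by simp [Complex.norm_exp]
  refine ((hf.trans h1).mul h2).congr_right fun t => ?_
  rw [← Real.exp_add]
  ring_nf

lemma isBigO_mul_cexp_neg_zero {f : ℝ → ℂ} {g : ℝ → ℝ} (hf : f =O[𝓝[>] 0] g) (y : ℂ) :
    (fun t : ℝ => f t * Complex.exp (-(y * t))) =O[𝓝[>] 0] g := by
  have h2 : (fun t : ℝ => Complex.exp (-(y * t))) =O[𝓝[>] 0] fun _ => (1 : ℝ) :=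
    (Continuous.tendsto (by fun_prop) 0).isBigO_one ℝ |>.mono nhdsWithin_le_nhds
  simpa using hf.mul h2

lemma continuous_cexp_neg_mul (y : ℂ) : Continuous fun t : ℝ => Complex.exp (-(y * t)) := by
  fun_prop

lemma mellinConvergent_mul_cexp {f : ℝ → ℂ} {b : ℝ} {K : ℕ} (hf : ContinuousOn f (Ioi 0))
    (htop : f =O[atTop] fun t : ℝ => t ^ K) (hbot : f =O[𝓝[>] 0] fun t : ℝ => t ^ (-b))
    {y w : ℂ} (hy : 0 < y.re) (hw : b < w.re) :
    MellinConvergent (fun t : ℝ => f t * Complex.exp (-(y * t))) w :=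
  mellinConvergent_of_isBigO_rpow_exp (half_pos hy)
    ((hf.mul (continuous_cexp_neg_mul y).continuousOn).locallyIntegrableOn measurableSet_Ioi)
    (isBigO_mul_cexp_neg htop hy) (isBigO_mul_cexp_neg_zero hbot y) hw

lemma mellin_differentiableAt_mul_cexp {f : ℝ → ℂ} {b : ℝ} {K : ℕ} (hf : ContinuousOn f (Ioi 0))
    (htop : f =O[atTop] fun t : ℝ => t ^ K) (hbot : f =O[𝓝[>] 0] fun t : ℝ => t ^ (-b))
    {y w : ℂ} (hy : 0 < y.re) (hw : b < w.re) :
    DifferentiableAt ℂ (mellin fun t : ℝ => f t * Complex.exp (-(y * t))) w :=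
  mellin_differentiableAt_of_isBigO_rpow_exp (half_pos hy)
    ((hf.mul (continuous_cexp_neg_mul y).continuousOn).locallyIntegrableOn measurableSet_Ioi)
    (isBigO_mul_cexp_neg htop hy) (isBigO_mul_cexp_neg_zero hbot y) hw

/-- The Mellin transform of `f(t) e ^ (-y t)` is holomorphic in `y`, by differentiation under the
integral. -/
lemma differentiableAt_mellin_mul_cexp {f : ℝ → ℂ} {b : ℝ} {K : ℕ} (hf : ContinuousOn f (Ioi 0))
    (htop : f =O[atTop] fun t : ℝ => t ^ K) (hbot : f =O[𝓝[>] 0] fun t : ℝ => t ^ (-b))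
    {y w : ℂ} (hy : 0 < y.re) (hw : b < w.re) :
    DifferentiableAt ℂ (fun y : ℂ => mellin (fun t : ℝ => f t * Complex.exp (-(y * t))) w) y := by
  have hconv : ∀ {z v : ℂ}, 0 < z.re → b < v.re →
      MellinConvergent (fun t : ℝ => f t * Complex.exp (-(z * t))) v := fun hz hv =>
    mellinConvergent_mul_cexp hf htop hbot hz hv
  have hU : {z : ℂ | y.re / 2 < z.re} ∈ 𝓝 y :=
    (isOpen_lt continuous_const Complex.continuous_re).mem_nhds (half_lt_self hy)
  have hb := hconv (z := (y.re / 2 : ℝ)) (v := w + 1) (by simpa using hy) (by simp; linarith)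
  have key := hasDerivAt_integral_of_dominated_loc_of_deriv_le
    (μ := volume.restrict (Ioi (0 : ℝ))) (𝕜 := ℂ) (x₀ := y) (s := {z : ℂ | y.re / 2 < z.re})
    (F := fun z t => (t : ℂ) ^ (w - 1) • (f t * Complex.exp (-(z * t))))
    (F' := fun z t => (t : ℂ) ^ (w - 1) • (f t * (Complex.exp (-(z * t)) * -t)))
    (bound := fun t => ‖(t : ℂ) ^ (w + 1 - 1) • (f t * Complex.exp (-((y.re / 2 : ℝ) * t)))‖)
    hU ?_ (hconv hy hw) ?_ ?_ hb.norm ?_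
  · exact key.2.differentiableAt
  · filter_upwards [hU] with z hz
    exact (hconv ((half_pos hy).trans hz) hw).aestronglyMeasurable
  · have : AEStronglyMeasurable (fun t : ℝ =>
        ((t : ℂ) ^ (w - 1) • (f t * Complex.exp (-(y * t)))) * -(t : ℂ))
        (volume.restrict (Ioi (0 : ℝ))) :=
      (hconv hy hw).aestronglyMeasurable.mul (by fun_prop)
    refine this.congr (Eventually.of_forall fun t => ?_)
    simp only [smul_eq_mul]
    ring
  · refine (ae_restrict_iff' measurableSet_Ioi).2 (Eventually.of_forall fun t (ht : 0 < t) z hz => ?_)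
    have h0 : (t : ℂ) ≠ 0 := by exact_mod_cast ht.ne'
    have e : (t : ℂ) ^ (w - 1) • (f t * (Complex.exp (-(z * t)) * -t)) =
        -((t : ℂ) ^ (w + 1 - 1) * (f t * Complex.exp (-(z * t)))) := by
      rw [show w + 1 - 1 = (w - 1) + 1 by ring, Complex.cpow_add _ _ h0, Complex.cpow_one,
        smul_eq_mul]
      ring
    rw [e, norm_neg, norm_smul, norm_mul, norm_mul, norm_mul, Complex.norm_exp, Complex.norm_exp]
    have h2 : y.re / 2 < z.re := hz
    refine mul_le_mul_of_nonneg_left (mul_le_mul_of_nonneg_left (Real.exp_le_exp.2 ?_)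
      (norm_nonneg _)) (norm_nonneg _)
    have := mul_lt_mul_of_pos_right h2 ht
    rw [Complex.neg_re, Complex.neg_re, Complex.re_mul_ofReal, Complex.re_mul_ofReal,
      Complex.ofReal_re]
    linarith
  · refine Eventually.of_forall fun t z _ => ?_
    have h1 : HasDerivAt (fun z : ℂ => -(z * t)) (-t : ℂ) z := by
      convert! ((hasDerivAt_id z).mul_const (t : ℂ)).neg using 1
      simp
    simp only [smul_eq_mul]
    exact (h1.cexp.const_mul (f t)).const_mul _

/-- `∫ t ^ (v - 1) e ^ (-y t) dt = Γ(v) y ^ (-v)`; the case of real `y` extends by the identity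
theorem. -/
lemma hasMellin_cexp_neg {y v : ℂ} (hy : 0 < y.re) (hv : 0 < v.re) :
    HasMellin (fun t : ℝ => Complex.exp (-(y * t))) v (Complex.Gamma v * y ^ (-v)) := by
  have htop : (fun _ : ℝ => (1 : ℂ)) =O[atTop] fun t : ℝ => t ^ 0 := isBigO_of_le _ fun t => by simp
  have hbot : (fun _ : ℝ => (1 : ℂ)) =O[𝓝[>] 0] fun t : ℝ => t ^ (-0 : ℝ) :=
    isBigO_of_le _ fun t => by simp
  refine ⟨by simpa using mellinConvergent_mul_cexp continuousOn_const htop hbot hy hv, ?_⟩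
  have hopen : IsOpen {z : ℂ | 0 < z.re} := isOpen_lt continuous_const Complex.continuous_re
  have h1 : AnalyticOnNhd ℂ (fun z : ℂ => mellin (fun t : ℝ => Complex.exp (-(z * t))) v)
      {z : ℂ | 0 < z.re} := by
    refine DifferentiableOn.analyticOnNhd (fun z hz => ?_) hopen
    simpa using (differentiableAt_mellin_mul_cexp continuousOn_const htop hbot hz
      hv).differentiableWithinAt
  have h2 : AnalyticOnNhd ℂ (fun z : ℂ => Complex.Gamma v * z ^ (-v)) {z : ℂ | 0 < z.re} :=
    DifferentiableOn.analyticOnNhd (fun z hz => ((differentiableAt_id.cpow_const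
      (Or.inl hz)).const_mul _).differentiableWithinAt) hopen
  have hreal : ∀ x : ℝ, 0 < x →
      mellin (fun t : ℝ => Complex.exp (-((x : ℂ) * t))) v = Complex.Gamma v * (x : ℂ) ^ (-v) := by
    intro x hx
    have harg : (x : ℂ).arg ≠ Real.pi := by
      rw [Complex.arg_ofReal_of_nonneg hx.le]
      exact Real.pi_pos.ne
    have := Complex.integral_cpow_mul_exp_neg_mul_Ioi hv hx
    rw [one_div, Complex.inv_cpow _ _ harg, ← Complex.cpow_neg, mul_comm] at this
    simpa only [mellin, smul_eq_mul] using this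
  have hfreq : ∃ᶠ z in 𝓝[≠] (1 : ℂ), mellin (fun t : ℝ => Complex.exp (-(z * t))) v =
      Complex.Gamma v * z ^ (-v) := by
    have ht : Tendsto (fun x : ℝ => (x : ℂ)) (𝓝[>] 1) (𝓝[≠] (1 : ℂ)) := by
      refine tendsto_nhdsWithin_iff.2 ⟨?_, ?_⟩
      · simpa using (Complex.continuous_ofReal.tendsto 1).mono_left nhdsWithin_le_nhds
      · filter_upwards [self_mem_nhdsWithin] with x (hx : 1 < x)
        simpa using hx.ne'
    refine ht.frequently (Eventually.frequently ?_)
    filter_upwards [self_mem_nhdsWithin] with x (hx : 1 < x)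
    exact hreal x (by linarith)
  exact h1.eqOn_of_preconnected_of_frequently_eq h2
    (convex_halfSpace_re_gt 0).isPreconnected (by simp) hfreq hy

/-- The Mellin transform of a single term `a t ^ n e ^ (-y t)`. -/
lemma hasMellin_zpow_mul_cexp {y w : ℂ} (a : ℂ) (n : ℤ) (hy : 0 < y.re) (hw : 0 < (w + n).re) :
    HasMellin (fun t : ℝ => a * (t : ℂ) ^ n * Complex.exp (-(y * t))) w
      (a * (Complex.Gamma (w + n) * y ^ (-(w + n)))) := by
  have h := hasMellin_cexp_neg hy hw
  have hcongr : EqOn (fun t : ℝ => (t : ℂ) ^ (w - 1) • (a * (t : ℂ) ^ n * Complex.exp (-(y * t))))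
      (fun t : ℝ => a * ((t : ℂ) ^ (w + n - 1) • Complex.exp (-(y * t)))) (Ioi 0) := by
    intro t (ht : 0 < t)
    have h0 : (t : ℂ) ≠ 0 := by exact_mod_cast ht.ne'
    simp only [smul_eq_mul]
    rw [show w + n - 1 = (w - 1) + n by ring, Complex.cpow_add _ _ h0, Complex.cpow_intCast]
    ring
  refine ⟨?_, ?_⟩
  · exact (integrableOn_congr_fun hcongr measurableSet_Ioi).2 (Integrable.const_mul h.1 a)
  · rw [mellin, setIntegral_congr_fun measurableSet_Ioi hcongr, integral_const_mul, ← h.2, mellin]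

/-- The Gamma factor of the `k`-th term of the expansion, cleared of its poles. It holds also where
`Γ(w)` has a pole: both sides are then zero. -/
lemma risingProd_eq_polePoly_mul {r k : ℕ} {w : ℂ} (hw : 0 < (w - r + k).re) :
    polePoly r w * (Complex.Gamma w)⁻¹ * Complex.Gamma (w - r + k) = risingProd (w - r) k := by
  have hΓ := Complex.Gamma_ne_zero_of_re_pos hw
  rcases le_total r k with h | h
  · obtain ⟨m, rfl⟩ := Nat.exists_eq_add_of_le h
    have e : w - r + ((r + m : ℕ) : ℂ) = w + m := by push_cast; ring
    rw [e] at hΓ ⊢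
    rw [Gamma_inv_eq_risingProd_mul w m, risingProd_add, polePoly, sub_add_cancel]
    field_simp
  · obtain ⟨m, rfl⟩ := Nat.exists_eq_add_of_le h
    have e : w - ((k + m : ℕ) : ℂ) + k + m = w := by push_cast; ring
    have h1 := Gamma_inv_eq_risingProd_mul (w - ((k + m : ℕ) : ℂ) + k) m
    rw [e] at h1
    rw [polePoly, risingProd_add, mul_assoc (risingProd _ k), ← h1, mul_assoc, inv_mul_cancel₀ hΓ,
      mul_one]

/-- `((w - 1) ⋯ (w - r)) Γ(w)⁻¹` times the Mellin transform of `h(t) e ^ (-y t)`, with the first `K`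
terms of the expansion of `h` at `0` integrated in closed form. The integral of the remainder
converges for `re w > r - K`, which gives the continuation to this half-plane. -/
noncomputable def truncatedMellin (h : ℝ → ℂ) (a : ℕ → ℂ) (r K : ℕ) (y w : ℂ) : ℂ :=
  (∑ k ∈ Finset.range K, a k * (risingProd (w - r) k * y ^ (-(w - r + k)))) +
    polePoly r w * (Complex.Gamma w)⁻¹ *
      mellin (fun t : ℝ => laurentRem h a r K t * Complex.exp (-(y * t))) w

section

variable {h : ℝ → ℂ} {a : ℕ → ℂ} {r : ℕ}

lemma truncatedMellin_succ (hh : HasPoleExpansion h r)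
    (ha : ∀ K : ℕ, laurentRem h a r K =O[𝓝[>] 0] fun t : ℝ => t ^ (-((r : ℝ) - K)))
    {K : ℕ} {y w : ℂ} (hy : 0 < y.re) (hw : (r : ℝ) - K < w.re) :
    truncatedMellin h a r (K + 1) y w = truncatedMellin h a r K y w := by
  have hw' : 0 < (w - r + K).re := by simp; linarith
  have e : w + (((K : ℤ) - (r : ℤ) : ℤ) : ℂ) = w - r + K := by push_cast; ring
  have h1 : MellinConvergent (fun t : ℝ => laurentRem h a r (K + 1) t * Complex.exp (-(y * t))) w :=
    mellinConvergent_mul_cexp (continuousOn_laurentRem hh a _) (laurentRem_isBigO_atTop hh a _)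
      (ha _) hy (by push_cast; linarith)
  have h2 := hasMellin_zpow_mul_cexp (a K) ((K : ℤ) - (r : ℤ)) hy (w := w) (by rwa [e])
  have h3 := (hasMellin_add h1 h2.1).2
  rw [h2.2, e] at h3
  have h4 : (fun t : ℝ => laurentRem h a r (K + 1) t * Complex.exp (-(y * t)) +
      a K * (t : ℂ) ^ ((K : ℤ) - (r : ℤ)) * Complex.exp (-(y * t))) =
      fun t : ℝ => laurentRem h a r K t * Complex.exp (-(y * t)) := by
    funext t
    simp only [laurentRem, Finset.sum_range_succ]
    ring
  rw [h4] at h3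
  rw [truncatedMellin, truncatedMellin, Finset.sum_range_succ, h3,
    ← risingProd_eq_polePoly_mul hw']
  ring

lemma truncatedMellin_eq (hh : HasPoleExpansion h r)
    (ha : ∀ K : ℕ, laurentRem h a r K =O[𝓝[>] 0] fun t : ℝ => t ^ (-((r : ℝ) - K)))
    {K L : ℕ} {y w : ℂ} (hy : 0 < y.re) (hK : (r : ℝ) - K < w.re) (hL : (r : ℝ) - L < w.re) :
    truncatedMellin h a r K y w = truncatedMellin h a r L y w := by
  wlog hKL : K ≤ L generalizing K L
  · exact (this hL hK (le_of_not_ge hKL)).symm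
  induction L, hKL using Nat.le_induction with
  | base => rfl
  | succ L hL' ih =>
    have : (K : ℝ) ≤ L := by exact_mod_cast hL'
    rw [truncatedMellin_succ hh ha hy (by linarith), ih (by linarith)]

lemma differentiableAt_truncatedMellin (hh : HasPoleExpansion h r)
    (ha : ∀ K : ℕ, laurentRem h a r K =O[𝓝[>] 0] fun t : ℝ => t ^ (-((r : ℝ) - K)))
    {K : ℕ} {y w : ℂ} (hy : 0 < y.re) (hK : (r : ℝ) - K < w.re) :
    DifferentiableAt ℂ (truncatedMellin h a r K y) w := by
  have hy0 : y ≠ 0 := by rintro rfl; simp at hy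
  have h1 := mellin_differentiableAt_mul_cexp (continuousOn_laurentRem hh a K)
    (laurentRem_isBigO_atTop hh a K) (ha K) hy hK
  have h2 := Complex.differentiable_one_div_Gamma w
  have h3 := differentiable_polePoly r w
  have h4 : ∀ k, DifferentiableAt ℂ (fun w : ℂ => risingProd (w - r) k) w := fun k =>
    ((differentiable_risingProd k).comp (differentiable_id.sub_const _)) w
  have h5 : ∀ k : ℕ, DifferentiableAt ℂ (fun w : ℂ => y ^ (-(w - r + k))) w := fun k =>
    DifferentiableAt.const_cpow (by fun_prop) (Or.inl hy0)
  unfold truncatedMellin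
  exact (DifferentiableAt.fun_sum fun k _ => ((h4 k).mul (h5 k)).const_mul _).add ((h3.mul h2).mul h1)

lemma hasDerivAt_Gamma_inv_zero : HasDerivAt (fun w : ℂ => (Complex.Gamma w)⁻¹) 1 0 := by
  have h1 : (fun w : ℂ => (Complex.Gamma w)⁻¹) = fun w => w * (Complex.Gamma (w + 1))⁻¹ := by
    funext w
    exact Complex.one_div_Gamma_eq_self_mul_one_div_Gamma_add_one w
  have h2 : DifferentiableAt ℂ (fun w : ℂ => (Complex.Gamma (w + 1))⁻¹) 0 :=
    (Complex.differentiable_one_div_Gamma.comp (differentiable_id.add_const (1 : ℂ))) 0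
  rw [h1]
  convert! (hasDerivAt_id (0 : ℂ)).mul h2.hasDerivAt using 1
  simp

/-- The Mellin transform of `h(t) e ^ (-y t)`, divided by `Γ(w)`, continues to `w ∈ ℂ` with at most
simple poles at `1, …, r`. Its derivative at `w = 0` is holomorphic in `y`: it is the sum of
elementary functions and of a Laplace transform, since `1 / Γ` vanishes at `0`. -/
theorem HasPoleExpansion.exists_entire (hh : HasPoleExpansion h r) :
    ∃ E : ℂ → ℂ → ℂ,
      (∀ y : ℂ, 0 < y.re → Differentiable ℂ (E y) ∧ ∀ w : ℂ, r < w.re →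
        MellinConvergent (fun t : ℝ => h t * Complex.exp (-(y * t))) w ∧
        (Complex.Gamma w)⁻¹ * mellin (fun t : ℝ => h t * Complex.exp (-(y * t))) w =
          E y w / polePoly r w) ∧
      DifferentiableOn ℂ (fun y => deriv (fun w => E y w / polePoly r w) 0) {y | 0 < y.re} := by
  obtain ⟨a, ha⟩ := hh.exists_coeff
  -- truncations at different orders agree where both make sense, so the order may depend on `w`
  set E : ℂ → ℂ → ℂ := fun y w => truncatedMellin h a r (⌈(r : ℝ) - w.re⌉₊ + 1) y w with hE
  have hEK : ∀ (y w : ℂ) (K : ℕ), 0 < y.re → (r : ℝ) - K < w.re →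
      E y w = truncatedMellin h a r K y w := fun y w K hy hw =>
    truncatedMellin_eq hh ha hy
      (by have := Nat.le_ceil ((r : ℝ) - w.re); push_cast; linarith) hw
  have hev : ∀ (y w : ℂ) (K : ℕ), 0 < y.re → (r : ℝ) - K < w.re →
      E y =ᶠ[𝓝 w] truncatedMellin h a r K y := fun y w K hy hw => by
    have : {z : ℂ | (r : ℝ) - K < z.re} ∈ 𝓝 w :=
      (isOpen_lt continuous_const Complex.continuous_re).mem_nhds hw
    filter_upwards [this] with z hz using hEK y z K hy hz
  refine ⟨E, fun y hy => ⟨fun w => ?_, fun w hw => ⟨?_, ?_⟩⟩, ?_⟩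
  · obtain ⟨K, hK⟩ := exists_nat_gt ((r : ℝ) - w.re)
    exact (differentiableAt_truncatedMellin hh ha hy (by linarith)).congr_of_eventuallyEq
      (hev y w K hy (by linarith))
  · have := mellinConvergent_mul_cexp (continuousOn_laurentRem hh a 0)
      (laurentRem_isBigO_atTop hh a 0) (ha 0) hy (w := w) (by simpa using hw)
    simpa [laurentRem] using this
  · rw [hEK y w 0 hy (by simpa using hw), truncatedMellin]
    have := polePoly_ne_zero_of_lt_re hw
    simp only [Finset.range_zero, Finset.sum_empty, zero_add, laurentRem, sub_zero]
    field_simp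
  · -- truncation at the order `r + 1` is valid near `w = 0`
    set ρ : ℕ → ℂ → ℂ := fun k w => risingProd (w - r) k / polePoly r w with hρ
    set J : ℂ → ℂ → ℂ := fun y w =>
      mellin (fun t : ℝ => laurentRem h a r (r + 1) t * Complex.exp (-(y * t))) w with hJ
    have hρd : ∀ k, DifferentiableAt ℂ (ρ k) 0 := fun k =>
      (((differentiable_risingProd k).comp (differentiable_id.sub_const (r : ℂ))) 0).div
        (differentiable_polePoly r 0) (polePoly_zero_ne_zero r)
    have hderiv : ∀ y : ℂ, 0 < y.re → deriv (fun w => E y w / polePoly r w) 0 =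
        (∑ k ∈ Finset.range (r + 1), a k * (deriv (ρ k) 0 * y ^ (-((0 : ℂ) - r + k)) +
          ρ k 0 * (y ^ (-((0 : ℂ) - r + k)) * Complex.log y * -1))) + J y 0 := by
      intro y hy
      have hy0 : y ≠ 0 := by rintro rfl; simp at hy
      have e1 : (fun w => E y w / polePoly r w) =ᶠ[𝓝 0] fun w =>
          (∑ k ∈ Finset.range (r + 1), a k * (ρ k w * y ^ (-(w - r + k)))) +
            (Complex.Gamma w)⁻¹ * J y w := by
        have hp : ∀ᶠ w in 𝓝 (0 : ℂ), polePoly r w ≠ 0 :=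
          (differentiable_polePoly r).continuous.continuousAt.eventually_ne
            (polePoly_zero_ne_zero r)
        filter_upwards [hev y 0 (r + 1) hy (by simp), hp] with w hw hpw
        rw [hw, truncatedMellin, add_div, Finset.sum_div]
        congr 1
        · refine Finset.sum_congr rfl fun k _ => ?_
          simp only [hρ]
          field_simp
        · simp only [hJ]
          field_simp
      have hJd : DifferentiableAt ℂ (J y) 0 :=
        mellin_differentiableAt_mul_cexp (continuousOn_laurentRem hh a _)
          (laurentRem_isBigO_atTop hh a _) (ha _) hy (by simp)
      have h1 : ∀ k : ℕ, HasDerivAt (fun w : ℂ => y ^ (-(w - r + k)))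
          (y ^ (-((0 : ℂ) - r + k)) * Complex.log y * -1) 0 := fun k => by
        have : HasDerivAt (fun w : ℂ => -(w - r + k)) (-1) 0 :=
          (((hasDerivAt_id (0 : ℂ)).sub_const _).add_const _).neg
        exact this.const_cpow (Or.inl hy0)
      have h2 := (HasDerivAt.fun_sum (u := Finset.range (r + 1)) fun k _ =>
        (((hρd k).hasDerivAt.mul (h1 k)).const_mul (a k))).add
          (hasDerivAt_Gamma_inv_zero.mul hJd.hasDerivAt)
      rw [e1.deriv_eq]
      refine h2.deriv.trans ?_
      simp
    refine DifferentiableOn.congr ?_ hderiv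
    intro y (hy : 0 < y.re)
    have hslit : y ∈ Complex.slitPlane := Or.inl hy
    refine DifferentiableAt.differentiableWithinAt (DifferentiableAt.add ?_ ?_)
    · refine DifferentiableAt.fun_sum fun k _ => ?_
      have h1 : DifferentiableAt ℂ (fun y : ℂ => y ^ (-((0 : ℂ) - r + k))) y :=
        DifferentiableAt.cpow_const differentiableAt_id hslit
      have h2 : DifferentiableAt ℂ Complex.log y := Complex.differentiableAt_log hslit
      fun_prop
    · exact differentiableAt_mellin_mul_cexp (continuousOn_laurentRem hh a _)
        (laurentRem_isBigO_atTop hh a _) (ha _) hy (by simp)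

end

/-! ### Dirichlet series with exponential sums having a pole at the origin -/

section

variable {ι : Type*} {lam : ι → ℝ} {H : ℝ → ℝ} {r : ℕ}

/-- `∑ (λ_i + y)^(-w)` as a Mellin transform of `H(t) e ^ (-y t)`, where `H(t) = ∑ e ^ (-λ_i t)`.
Absolute convergence comes for free, as the finite partial sums are bounded by the integral. -/
lemma hasSum_cpow_neg_of_hasSum_exp [Countable ι] (hlam : ∀ i, 0 ≤ lam i)
    (hsum : ∀ t : ℝ, 0 < t → HasSum (fun i => Real.exp (-(lam i * t))) (H t))
    {y w : ℂ} (hy : 0 < y.re) (hw : 0 < w.re)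
    (hconv : MellinConvergent (fun t : ℝ => (H t : ℂ) * Complex.exp (-(y * t))) w) :
    HasSum (fun i => ((lam i : ℂ) + y) ^ (-w))
      ((Complex.Gamma w)⁻¹ * mellin (fun t : ℝ => (H t : ℂ) * Complex.exp (-(y * t))) w) := by
  set F : ι → ℝ → ℂ := fun i t => (t : ℂ) ^ (w - 1) • Complex.exp (-(((lam i : ℂ) + y) * t)) with hF
  have hz : ∀ i, 0 < ((lam i : ℂ) + y).re := fun i => by
    simpa using add_pos_of_nonneg_of_pos (hlam i) hy
  have hM : ∀ i, HasMellin (fun t : ℝ => Complex.exp (-(((lam i : ℂ) + y) * t))) w _ := fun i =>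
    hasMellin_cexp_neg (hz i) hw
  have hFt : ∀ i t, F i t =
      ((t : ℂ) ^ (w - 1) * Complex.exp (-(y * t))) * (Real.exp (-(lam i * t)) : ℝ) := fun i t => by
    simp only [hF, smul_eq_mul]
    rw [add_mul, neg_add_rev, Complex.exp_add]
    push_cast
    ring
  have hFs : ∀ t ∈ Ioi (0 : ℝ), HasSum (fun i => F i t)
      ((t : ℂ) ^ (w - 1) • ((H t : ℂ) * Complex.exp (-(y * t)))) := by
    intro t ht
    have := (Complex.hasSum_ofReal.2 (hsum t ht)).mul_left
      ((t : ℂ) ^ (w - 1) * Complex.exp (-(y * t)))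
    simp only [hFt, smul_eq_mul]
    convert! this using 1
    ring
  have hnorm : ∀ i, IntegrableOn (fun t => ‖F i t‖) (Ioi 0) := fun i => (hM i).1.norm
  have hsummable : Summable fun i => ∫ t in Ioi (0 : ℝ), ‖F i t‖ := by
    refine summable_of_sum_le (c := ∫ t in Ioi (0 : ℝ),
      ‖(t : ℂ) ^ (w - 1) • ((H t : ℂ) * Complex.exp (-(y * t)))‖)
      (fun i => integral_nonneg fun t => norm_nonneg _) fun u => ?_
    rw [← integral_finsetSum u fun i _ => hnorm i]
    refine setIntegral_mono_on (integrable_finsetSum u fun i _ => hnorm i) hconv.norm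
      measurableSet_Ioi fun t ht => ?_
    have h1 : ∑ i ∈ u, Real.exp (-(lam i * t)) ≤ H t :=
      sum_le_hasSum u (fun i _ => (Real.exp_pos _).le) (hsum t ht)
    have h2 : ∀ i, ‖F i t‖ =
        ‖(t : ℂ) ^ (w - 1) * Complex.exp (-(y * t))‖ * Real.exp (-(lam i * t)) := fun i => by
      rw [hFt, norm_mul, Complex.norm_real, Real.norm_of_nonneg (Real.exp_pos _).le]
    simp only [h2]
    rw [← Finset.mul_sum, smul_eq_mul, show (t : ℂ) ^ (w - 1) * ((H t : ℂ) * Complex.exp (-(y * t))) =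
      (t : ℂ) ^ (w - 1) * Complex.exp (-(y * t)) * (H t : ℂ) by ring, norm_mul _ (H t : ℂ),
      Complex.norm_real]
    exact mul_le_mul_of_nonneg_left (h1.trans (le_abs_self _)) (norm_nonneg _)
  have key := hasSum_integral_of_summable_integral_norm (μ := volume.restrict (Ioi (0 : ℝ)))
    (F := F) (fun i => (hM i).1) hsummable
  rw [setIntegral_congr_fun measurableSet_Ioi fun t ht => (hFs t ht).tsum_eq] at key
  have h3 := key.mul_left (Complex.Gamma w)⁻¹
  convert! h3 using 2 with i
  have h4 : ∫ t in Ioi (0 : ℝ), F i t = Complex.Gamma w * ((lam i : ℂ) + y) ^ (-w) := (hM i).2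
  rw [h4, inv_mul_cancel_left₀ (Complex.Gamma_ne_zero_of_re_pos hw)]

/-- Removing finitely many terms from an exponential sum, among them all with `λ_i ≤ M`, and
shifting the exponents by `M`. -/
lemma HasPoleExpansion.sub_finset_sum
    (hsum : ∀ t : ℝ, 0 < t → HasSum (fun i => Real.exp (-(lam i * t))) (H t))
    (hH : HasPoleExpansion (fun t => (H t : ℂ)) r) (M : ℝ) (S : Finset ι)
    (hS : ∀ i ∉ S, M ≤ lam i) :
    (∀ t : ℝ, 0 < t → HasSum (fun i : {i // i ∉ S} => Real.exp (-((lam i - M) * t)))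
      (Real.exp (M * t) * (H t - ∑ i ∈ S, Real.exp (-(lam i * t))))) ∧
    HasPoleExpansion (fun t => ((Real.exp (M * t) *
      (H t - ∑ i ∈ S, Real.exp (-(lam i * t))) : ℝ) : ℂ)) r := by
  have h1 : ∀ t : ℝ, 0 < t → HasSum (fun i : {i // i ∉ S} => Real.exp (-((lam i - M) * t)))
      (Real.exp (M * t) * (H t - ∑ i ∈ S, Real.exp (-(lam i * t)))) := by
    intro t ht
    have h2 : HasSum (fun i : {i // i ∉ S} => Real.exp (-(lam i * t)))
        (H t - ∑ i ∈ S, Real.exp (-(lam i * t))) := by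
      rw [Finset.hasSum_compl_iff (f := fun i => Real.exp (-(lam i * t))), sub_add_cancel]
      exact hsum t ht
    convert! h2.mul_left (Real.exp (M * t)) using 2 with i
    rw [← Real.exp_add]
    ring_nf
  refine ⟨h1, ⟨?_, ?_, ?_⟩⟩
  · have hc : ContinuousOn H (Ioi 0) := by
      exact Complex.continuous_re.comp_continuousOn hH.continuousOn
    have h2 : ContinuousOn (fun t => Real.exp (M * t) *
        (H t - ∑ i ∈ S, Real.exp (-(lam i * t)))) (Ioi 0) :=
      ContinuousOn.mul (by fun_prop) (hc.sub (by fun_prop))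
    exact Complex.continuous_ofReal.comp_continuousOn h2
  · refine IsBigO.of_bound (Real.exp (M * 1) * (H 1 - ∑ i ∈ S, Real.exp (-(lam i * 1)))) ?_
    filter_upwards [eventually_ge_atTop 1] with t ht
    have h0 := h1 t (by linarith)
    rw [norm_one, mul_one, Complex.norm_real,
      Real.norm_of_nonneg (h0.nonneg fun i => (Real.exp_pos _).le)]
    refine hasSum_le (fun i => Real.exp_le_exp.2 ?_) h0 (h1 1 one_pos)
    nlinarith [hS i i.2]
  · obtain ⟨φ, hφ, hev⟩ := hH.analytic
    refine ⟨fun t => Complex.exp (M * t) * (φ t - (t : ℂ) ^ r * ∑ i ∈ S, Complex.exp (-(lam i * t))),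
      ?_, ?_⟩
    · have ho : AnalyticAt ℝ (fun t : ℝ => (t : ℂ)) 0 := Complex.ofRealCLM.analyticAt 0
      have he : ∀ c : ℂ, AnalyticAt ℝ (fun t : ℝ => Complex.exp (c * t)) 0 := fun c =>
        (analyticAt_cexp.restrictScalars (𝕜 := ℝ)).comp (analyticAt_const.mul ho)
      refine (he M).mul (hφ.sub ((ho.pow r).mul (Finset.analyticAt_fun_sum _ fun i _ => ?_)))
      simpa only [neg_mul] using he (-(lam i : ℂ))
    · filter_upwards [hev] with t ht
      rw [← ht]
      push_cast
      ring

lemma finite_setOf_le_of_summable_exp (h : Summable fun i => Real.exp (-(lam i * 1))) (M : ℝ) :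
    {i | lam i ≤ M}.Finite := by
  refine (h.tendsto_cofinite_zero.eventually_lt_const (Real.exp_pos (-M))).subset fun i hi h3 => ?_
  have h3' : Real.exp (-(lam i * 1)) < Real.exp (-M) := h3
  have hi' : lam i ≤ M := hi
  rw [Real.exp_lt_exp] at h3'
  linarith

/-- The Dirichlet series `∑ (λ_i + x)^(-w)` continues meromorphically to `w ∈ ℂ` with at most simple
poles at `1, …, r`, and for `re x > -M` the exponential of its derivative at `w = 0` is a finite
product of factors `(λ_i + x)⁻¹` times a nonvanishing holomorphic function of `x`. -/
theorem exists_entire_dirichlet [Countable ι]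
    (hsum : ∀ t : ℝ, 0 < t → HasSum (fun i => Real.exp (-(lam i * t))) (H t))
    (hH : HasPoleExpansion (fun t => (H t : ℂ)) r) (M : ℝ) :
    ∃ (S : Finset ι) (g : ℂ → ℂ), DifferentiableOn ℂ g {x | -M < x.re} ∧
      ∀ x : ℂ, -M < x.re → (∀ i, (lam i : ℂ) + x ≠ 0) →
        ∃ E : ℂ → ℂ, Differentiable ℂ E ∧
          (∀ w : ℂ, r < w.re → HasSum (fun i => ((lam i : ℂ) + x) ^ (-w)) (E w / polePoly r w)) ∧
          Complex.exp (deriv (fun w => E w / polePoly r w) 0) =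
            (∏ i ∈ S, ((lam i : ℂ) + x)⁻¹) * Complex.exp (g x) := by
  have hfin := finite_setOf_le_of_summable_exp (hsum 1 one_pos).summable M
  set S := hfin.toFinset with hSdef
  have hS : ∀ i ∉ S, M ≤ lam i := fun i hi => by
    have : ¬ lam i ≤ M := by simpa [hSdef] using hi
    linarith
  obtain ⟨hsum', hH'⟩ := HasPoleExpansion.sub_finset_sum hsum hH M S hS
  obtain ⟨E, hE, hD⟩ := hH'.exists_entire
  refine ⟨S, fun x => deriv (fun w => E (x + M) w / polePoly r w) 0, ?_, fun x hx hne => ?_⟩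
  · have : MapsTo (fun x : ℂ => x + M) {x : ℂ | -M < x.re} {y : ℂ | 0 < y.re} := fun x hx => by
      have hx' : -M < x.re := hx
      simp
      linarith
    exact hD.comp (by fun_prop) this
  have hy : 0 < (x + M : ℂ).re := by simp; linarith
  obtain ⟨hEd, hEw⟩ := hE _ hy
  have hpow : ∀ i, Differentiable ℂ fun w : ℂ => ((lam i : ℂ) + x) ^ (-w) := fun i w =>
    DifferentiableAt.const_cpow (by fun_prop) (Or.inl (hne i))
  refine ⟨fun w => polePoly r w * (∑ i ∈ S, ((lam i : ℂ) + x) ^ (-w)) + E (x + M) w, ?_, ?_, ?_⟩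
  · exact ((differentiable_polePoly r).mul
      (Differentiable.fun_sum fun i _ => hpow i)).add hEd
  · intro w hw
    have hp := polePoly_ne_zero_of_lt_re hw
    have h0 : 0 < w.re := (Nat.cast_nonneg r).trans_lt hw
    have h1 := hasSum_cpow_neg_of_hasSum_exp (lam := fun i : {i // i ∉ S} => lam i - M)
      (fun i => sub_nonneg.2 (hS i i.2)) hsum' hy h0 (hEw w hw).1
    rw [(hEw w hw).2] at h1
    have h2 : HasSum (fun i : {i // i ∉ S} => ((lam i : ℂ) + x) ^ (-w))
        (E (x + M) w / polePoly r w) := by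
      convert! h1 using 2 with i
      push_cast
      ring_nf
    rw [Finset.hasSum_compl_iff (f := fun i => ((lam i : ℂ) + x) ^ (-w))] at h2
    convert! h2 using 1
    field_simp
    ring
  · have hp : ∀ᶠ w in 𝓝 (0 : ℂ), polePoly r w ≠ 0 :=
      (differentiable_polePoly r).continuous.continuousAt.eventually_ne (polePoly_zero_ne_zero r)
    have h1 : (fun w => (polePoly r w * (∑ i ∈ S, ((lam i : ℂ) + x) ^ (-w)) + E (x + M) w) /
        polePoly r w) =ᶠ[𝓝 0] fun w => (∑ i ∈ S, ((lam i : ℂ) + x) ^ (-w)) +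
          E (x + M) w / polePoly r w := by
      filter_upwards [hp] with w hw
      field_simp
    have h2 : ∀ i, HasDerivAt (fun w : ℂ => ((lam i : ℂ) + x) ^ (-w))
        (-Complex.log ((lam i : ℂ) + x)) 0 := fun i => by
      convert! (hasDerivAt_neg (0 : ℂ)).const_cpow (Or.inl (hne i)) using 1
      simp
    have h3 : DifferentiableAt ℂ (fun w => E (x + M) w / polePoly r w) 0 :=
      (hEd 0).div (differentiable_polePoly r 0) (polePoly_zero_ne_zero r)
    have h4 := ((HasDerivAt.fun_sum (u := S) fun i _ => h2 i).add h3.hasDerivAt).deriv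
    rw [h1.deriv_eq]
    refine (congrArg Complex.exp h4).trans ?_
    rw [Complex.exp_add, Complex.exp_sum]
    congr 1
    refine Finset.prod_congr rfl fun i _ => ?_
    rw [Complex.exp_neg, Complex.exp_log (hne i)]

end

/-! ### The zeta functions of the Grover walks on `C_3` -/

/-- The action `diag (ζ ^ k, 1, ζ ^ (2 k)) A` of the evolution operator on the `k`-th Fourier mode,
where `ζ` is a primitive cube root of unity. -/
noncomputable def fourierBlock (ζ : ℂ) (A : Matrix (Fin 3) (Fin 3) ℂ) (k : ZMod 3) :
    Matrix (Fin 3) (Fin 3) ℂ :=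
  Matrix.diagonal (fun c => ζ ^ (k.val * (![1, 0, 2] : Fin 3 → ℕ) c)) * A

/-- The matrix of the discrete Fourier transform on `ZMod 3`. -/
noncomputable def fourierMatrix (ζ : ℂ) : Matrix (ZMod 3) (ZMod 3) ℂ :=
  Matrix.of fun x k => ζ ^ (k.val * x.val)

lemma evolutionOp_apply (A : Matrix (Fin 3) (Fin 3) ℂ) (p q : ZMod 3 × Fin 3) :
    evolutionOp 3 A p q = if p.1 - step 3 p.2 = q.1 then A p.2 q.2 else 0 := by
  rw [evolutionOp, Matrix.mul_apply, Finset.sum_eq_single (p.1 - step 3 p.2, p.2)]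
  · simp [shiftOp, coinOp, Matrix.one_apply]
  · intro b _ hb
    have : p ≠ (b.1 + step 3 b.2, b.2) := by
      rintro h
      apply hb
      rw [h]
      simp
    simp [shiftOp, this]
  · simp

lemma evolutionOp_mul_fourierMatrix {ζ : ℂ} (hζ : ζ ^ 3 = 1) (A : Matrix (Fin 3) (Fin 3) ℂ) :
    evolutionOp 3 A * (fourierMatrix ζ ⊗ₖ (1 : Matrix (Fin 3) (Fin 3) ℂ)) =
      (fourierMatrix ζ ⊗ₖ (1 : Matrix (Fin 3) (Fin 3) ℂ)) *
        (Matrix.blockDiagonal (fourierBlock ζ A)).submatrix Prod.swap Prod.swap := by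
  have hexp : ∀ (k x : ZMod 3) (c : Fin 3), (k.val * (x - step 3 c).val) % 3 =
      (k.val * x.val + k.val * (![1, 0, 2] : Fin 3 → ℕ) c) % 3 := by decide
  ext ⟨x, c⟩ ⟨k, d⟩
  have h1 : ζ ^ (k.val * (x - step 3 c).val) =
      ζ ^ (k.val * x.val) * ζ ^ (k.val * (![1, 0, 2] : Fin 3 → ℕ) c) := by
    rw [← pow_add, pow_eq_pow_mod _ hζ, hexp, ← pow_eq_pow_mod _ hζ]
  rw [Matrix.mul_apply, Matrix.mul_apply, Finset.sum_eq_single (x - step 3 c, d),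
    Finset.sum_eq_single (k, c)]
  · simp only [evolutionOp_apply, fourierMatrix, fourierBlock, Matrix.kroneckerMap_apply,
      Matrix.of_apply, Matrix.one_apply_eq, Matrix.submatrix_apply, Prod.swap_prod_mk,
      Matrix.blockDiagonal_apply, if_true, h1, Matrix.diagonal_mul]
    ring
  · rintro ⟨j, e⟩ _ hb
    by_cases he : c = e
    · subst he
      have : j ≠ k := fun h => hb (by rw [h])
      simp [Matrix.blockDiagonal_apply, this]
    · simp [he]
  · simp
  · rintro ⟨y, e⟩ _ hb
    by_cases he : e = d
    · subst he
      have : x - step 3 c ≠ y := fun h => hb (by rw [h])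
      simp [evolutionOp_apply, this]
    · simp [he]
  · simp

lemma det_fourierMatrix_ne_zero {ζ : ℂ} (hζ : ζ ^ 2 + ζ + 1 = 0) :
    (fourierMatrix ζ).det ≠ 0 := by
  have h1 : (fourierMatrix ζ).det = ζ ^ 5 - 2 * ζ ^ 4 + 2 * ζ ^ 2 - ζ := by
    refine (Matrix.det_fin_three (fourierMatrix ζ)).trans ?_
    have h0 : (0 : ZMod 3).val = 0 := rfl
    have h1 : (1 : ZMod 3).val = 1 := rfl
    have h2 : (2 : ZMod 3).val = 2 := rfl
    change fourierMatrix ζ (0 : ZMod 3) (0 : ZMod 3) * fourierMatrix ζ (1 : ZMod 3) (1 : ZMod 3) *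
      fourierMatrix ζ (2 : ZMod 3) (2 : ZMod 3) - fourierMatrix ζ (0 : ZMod 3) (0 : ZMod 3) *
      fourierMatrix ζ (1 : ZMod 3) (2 : ZMod 3) * fourierMatrix ζ (2 : ZMod 3) (1 : ZMod 3) -
      fourierMatrix ζ (0 : ZMod 3) (1 : ZMod 3) * fourierMatrix ζ (1 : ZMod 3) (0 : ZMod 3) *
      fourierMatrix ζ (2 : ZMod 3) (2 : ZMod 3) + fourierMatrix ζ (0 : ZMod 3) (1 : ZMod 3) *
      fourierMatrix ζ (1 : ZMod 3) (2 : ZMod 3) * fourierMatrix ζ (2 : ZMod 3) (0 : ZMod 3) +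
      fourierMatrix ζ (0 : ZMod 3) (2 : ZMod 3) * fourierMatrix ζ (1 : ZMod 3) (0 : ZMod 3) *
      fourierMatrix ζ (2 : ZMod 3) (1 : ZMod 3) - fourierMatrix ζ (0 : ZMod 3) (2 : ZMod 3) *
      fourierMatrix ζ (1 : ZMod 3) (1 : ZMod 3) * fourierMatrix ζ (2 : ZMod 3) (0 : ZMod 3) = _
    simp only [fourierMatrix, Matrix.of_apply, h0, h1, h2]
    ring
  -- the square of the determinant is the discriminant `-27` of `X ^ 3 - 1`
  have h2 : (fourierMatrix ζ).det ^ 2 = -27 := by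
    rw [h1]
    linear_combination (ζ ^ 8 - 5 * ζ ^ 7 + 8 * ζ ^ 6 + ζ ^ 5 - 19 * ζ ^ 4 + 22 * ζ ^ 3 +
      ζ ^ 2 - 27 * ζ + 27) * hζ
  intro h
  rw [h] at h2
  norm_num at h2

/-- The evolution operator is block diagonal in the Fourier basis. -/
lemma det_one_sub_smul_evolutionOp {ζ : ℂ} (hζ : ζ ^ 2 + ζ + 1 = 0)
    (A : Matrix (Fin 3) (Fin 3) ℂ) (u : ℂ) :
    (1 - u • evolutionOp 3 A).det = ∏ k : ZMod 3, (1 - u • fourierBlock ζ A k).det := by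
  have hζ3 : ζ ^ 3 = 1 := by linear_combination (ζ - 1) * hζ
  set F : Matrix (ZMod 3 × Fin 3) (ZMod 3 × Fin 3) ℂ :=
    fourierMatrix ζ ⊗ₖ (1 : Matrix (Fin 3) (Fin 3) ℂ) with hF
  set B := Matrix.blockDiagonal fun k => 1 - u • fourierBlock ζ A k with hB
  have hdet : F.det ≠ 0 := by
    rw [hF, Matrix.det_kronecker, Matrix.det_one, one_pow, mul_one]
    exact pow_ne_zero _ (det_fourierMatrix_ne_zero hζ)
  have hB' : B.submatrix (Equiv.prodComm (ZMod 3) (Fin 3)) (Equiv.prodComm (ZMod 3) (Fin 3)) =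
      1 - u • (Matrix.blockDiagonal (fourierBlock ζ A)).submatrix Prod.swap Prod.swap := by
    ext ⟨x, c⟩ ⟨y, d⟩
    by_cases h : x = y
    · subst h
      simp [hB, Matrix.blockDiagonal_apply, Matrix.one_apply]
    · simp [hB, Matrix.blockDiagonal_apply, h]
  have hconj : (1 - u • evolutionOp 3 A) * F =
      F * B.submatrix (Equiv.prodComm (ZMod 3) (Fin 3)) (Equiv.prodComm (ZMod 3) (Fin 3)) := by
    rw [hB', Matrix.sub_mul, Matrix.mul_sub, Matrix.smul_mul, Matrix.mul_smul,
      evolutionOp_mul_fourierMatrix hζ3, Matrix.one_mul, Matrix.mul_one]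
  have h1 := congrArg Matrix.det hconj
  rw [Matrix.det_mul, Matrix.det_mul, Matrix.det_submatrix_equiv_self, hB,
    Matrix.det_blockDiagonal, mul_comm F.det] at h1
  exact mul_right_cancel₀ hdet h1

lemma exists_primitive_cube_root : ∃ ζ : ℂ, ζ ^ 2 + ζ + 1 = 0 := by
  refine ⟨(-1 + Real.sqrt 3 * Complex.I) / 2, ?_⟩
  have h : ((Real.sqrt 3 : ℝ) : ℂ) ^ 2 = 3 := by
    rw [← Complex.ofReal_pow, Real.sq_sqrt (by norm_num)]
    norm_num
  linear_combination (-1 / 4 : ℂ) * h + ((Real.sqrt 3 : ℝ) : ℂ) ^ 2 / 4 * Complex.I_sq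

lemma det_one_sub_smul_fourierBlock_groverCoinM {a b : ℂ} (hab : a * b = 1) (u : ℂ) :
    (1 - u • (Matrix.diagonal ![a, 1, b] * groverCoinM)).det =
      1 + u * (a + 1 + b) / 3 - u ^ 2 * (a + 1 + b) / 3 - u ^ 3 := by
  rw [Matrix.det_fin_three]
  simp [groverCoinM]
  linear_combination (-u ^ 2 / 3 - u ^ 3) * hab

lemma det_one_sub_smul_fourierBlock_groverCoinF {a b : ℂ} (hab : a * b = 1) (u : ℂ) :
    (1 - u • (Matrix.diagonal ![a, 1, b] * groverCoinF)).det =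
      1 - u * (2 * a - 1 + 2 * b) / 3 + u ^ 2 * (1 - 2 * a - 2 * b) / 3 + u ^ 3 := by
  rw [Matrix.det_fin_three]
  simp [groverCoinF]
  linear_combination (u ^ 2 / 3 + u ^ 3) * hab

lemma prod_det_fourierBlock {ζ : ℂ} (hζ : ζ ^ 2 + ζ + 1 = 0) (A : Matrix (Fin 3) (Fin 3) ℂ)
    (u : ℂ) :
    (1 - u • evolutionOp 3 A).det =
      (1 - u • (Matrix.diagonal ![1, 1, 1] * A)).det *
      (1 - u • (Matrix.diagonal ![ζ, 1, ζ ^ 2] * A)).det *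
      (1 - u • (Matrix.diagonal ![ζ ^ 2, 1, ζ] * A)).det := by
  have hζ3 : ζ ^ 3 = 1 := by linear_combination (ζ - 1) * hζ
  rw [det_one_sub_smul_evolutionOp hζ]
  refine (Fin.prod_univ_three fun k : Fin 3 => (1 - u • fourierBlock ζ A k).det).trans ?_
  have h4 : ζ ^ 4 = ζ := by linear_combination ζ * hζ3
  congr 3 <;> unfold fourierBlock <;> congr 4 <;> funext c <;> fin_cases c <;>
    simp [ZMod.val, h4]

lemma det_evolutionOp_groverCoinM (u : ℂ) :
    (1 - u • evolutionOp 3 groverCoinM).det = (1 - u) * (1 + u) ^ 2 * (1 - u ^ 3) ^ 2 := by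
  obtain ⟨ζ, hζ⟩ := exists_primitive_cube_root
  have hζ3 : ζ ^ 3 = 1 := by linear_combination (ζ - 1) * hζ
  rw [prod_det_fourierBlock hζ, det_one_sub_smul_fourierBlock_groverCoinM (by ring),
    det_one_sub_smul_fourierBlock_groverCoinM (by linear_combination hζ3),
    det_one_sub_smul_fourierBlock_groverCoinM (by linear_combination hζ3),
    show ζ + 1 + ζ ^ 2 = 0 by linear_combination hζ,
    show ζ ^ 2 + 1 + ζ = 0 by linear_combination hζ]
  ring

lemma det_evolutionOp_groverCoinF (u : ℂ) :
    (1 - u • evolutionOp 3 groverCoinF).det =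
      (1 - u) ^ 2 * (1 + u) ^ 3 * (1 + u ^ 2) ^ 2 := by
  obtain ⟨ζ, hζ⟩ := exists_primitive_cube_root
  have hζ3 : ζ ^ 3 = 1 := by linear_combination (ζ - 1) * hζ
  rw [prod_det_fourierBlock hζ, det_one_sub_smul_fourierBlock_groverCoinF (by ring),
    det_one_sub_smul_fourierBlock_groverCoinF (by linear_combination hζ3),
    det_one_sub_smul_fourierBlock_groverCoinF (by linear_combination hζ3),
    show 2 * ζ - 1 + 2 * ζ ^ 2 = -3 by linear_combination 2 * hζ,
    show 2 * ζ ^ 2 - 1 + 2 * ζ = -3 by linear_combination 2 * hζ,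
    show 1 - 2 * ζ - 2 * ζ ^ 2 = 3 by linear_combination -2 * hζ,
    show 1 - 2 * ζ ^ 2 - 2 * ζ = 3 by linear_combination -2 * hζ]
  ring

lemma walkZeta_groverCoinM (u : ℂ) :
    ((u ^ 2 - 1) ^ 2 * (u ^ 3 - 1) ^ 2 ≠ 0 →
      walkZeta 3 groverCoinM u =
        ((-((u - 1) / ((u ^ 2 - 1) ^ 2 * (u ^ 3 - 1) ^ 2)) : ℂ) : OnePoint ℂ)) ∧
    ((u ^ 2 - 1) ^ 2 * (u ^ 3 - 1) ^ 2 = 0 → walkZeta 3 groverCoinM u = OnePoint.infty) := by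
  have h : (u ^ 2 - 1) ^ 2 * (u ^ 3 - 1) ^ 2 =
      -((u - 1) * ((1 - u) * (1 + u) ^ 2 * (1 - u ^ 3) ^ 2)) := by ring
  rw [walkZeta, det_evolutionOp_groverCoinM, h]
  refine ⟨fun hne => ?_, fun h0 => ?_⟩
  · have h1 := right_ne_zero_of_mul (neg_ne_zero.1 hne)
    have h2 := left_ne_zero_of_mul (neg_ne_zero.1 hne)
    rw [if_neg h1, div_neg, neg_neg, div_mul_cancel_left₀ h2]
  · rw [if_pos]
    rcases mul_eq_zero.1 (neg_eq_zero.1 h0) with h1 | h1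
    · rw [sub_eq_zero.1 h1]
      ring
    · exact h1

lemma walkZeta_groverCoinF (u : ℂ) :
    ((u ^ 2 - 1) * (u ^ 4 - 1) ^ 2 ≠ 0 →
      walkZeta 3 groverCoinF u =
        (((u - 1) / ((u ^ 2 - 1) * (u ^ 4 - 1) ^ 2) : ℂ) : OnePoint ℂ)) ∧
    ((u ^ 2 - 1) * (u ^ 4 - 1) ^ 2 = 0 → walkZeta 3 groverCoinF u = OnePoint.infty) := by
  have h : (u ^ 2 - 1) * (u ^ 4 - 1) ^ 2 =
      (u - 1) * ((1 - u) ^ 2 * (1 + u) ^ 3 * (1 + u ^ 2) ^ 2) := by ring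
  rw [walkZeta, det_evolutionOp_groverCoinF, h]
  refine ⟨fun hne => ?_, fun h0 => ?_⟩
  · have h1 := right_ne_zero_of_mul hne
    have h2 := left_ne_zero_of_mul hne
    rw [if_neg h1, div_mul_cancel_left₀ h2]
  · rw [if_pos]
    rcases mul_eq_zero.1 h0 with h1 | h1
    · rw [sub_eq_zero.1 h1]
      ring
    · exact h1

/-- A walk zeta function whose characteristic polynomial is, up to sign, palindromic of degree `D`
is an absolute automorphic form of weight `-D`. -/
lemma isAbsoluteAutomorphicForm_walkZeta {N : ℕ} [NeZero N] {A : Matrix (Fin 3) (Fin 3) ℂ} {D : ℕ}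
    {C : ℂ} (hC : C = 1 ∨ C = -1)
    (h : ∀ u : ℂ, u ≠ 0 → (1 - u • evolutionOp N A).det =
      C * u ^ D * (1 - u⁻¹ • evolutionOp N A).det) :
    IsAbsoluteAutomorphicForm (fun x : ℝ => walkZeta N A x) (-(D : ℤ)) := by
  refine ⟨C, hC, fun x hx => ?_⟩
  have hx' : (x : ℂ) ≠ 0 := by exact_mod_cast hx
  have hC0 : C ≠ 0 := by rcases hC with rfl | rfl <;> simp
  have h1 := h x hx'
  have hCx : C * (x : ℂ) ^ D ≠ 0 := mul_ne_zero hC0 (pow_ne_zero _ hx')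
  have e : ((1 / x : ℝ) : ℂ) = (x : ℂ)⁻¹ := by push_cast; rw [one_div]
  simp only [walkZeta, e, neg_neg, zpow_natCast]
  by_cases h0 : (1 - (x : ℂ)⁻¹ • evolutionOp N A).det = 0
  · rw [h0, mul_zero] at h1
    rw [if_pos h0, if_pos h1, OnePoint.map_infty]
  · have h2 : (1 - (x : ℂ) • evolutionOp N A).det ≠ 0 := by
      rw [h1]
      exact mul_ne_zero hCx h0
    rw [if_neg h0, if_neg h2, OnePoint.map_some, h1, mul_inv, mul_inv_cancel_left₀ hCx]

lemma isAbsoluteAutomorphicForm_groverZetaM : IsAbsoluteAutomorphicForm groverZetaM (-9) := by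
  refine isAbsoluteAutomorphicForm_walkZeta (D := 9) (C := -1) (Or.inr rfl) fun u hu => ?_
  rw [det_evolutionOp_groverCoinM, det_evolutionOp_groverCoinM]
  field_simp
  ring

lemma isAbsoluteAutomorphicForm_groverZetaF : IsAbsoluteAutomorphicForm groverZetaF (-9) := by
  refine isAbsoluteAutomorphicForm_walkZeta (D := 9) (C := 1) (Or.inl rfl) fun u hu => ?_
  rw [det_evolutionOp_groverCoinF, det_evolutionOp_groverCoinF]
  field_simp
  ring

/-! ### Multiple Hurwitz zeta and multiple gamma functions -/

lemma HasPoleExpansion.mul {h₁ h₂ : ℝ → ℂ} {r₁ r₂ : ℕ} (H₁ : HasPoleExpansion h₁ r₁)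
    (H₂ : HasPoleExpansion h₂ r₂) : HasPoleExpansion (fun t => h₁ t * h₂ t) (r₁ + r₂) := by
  refine ⟨H₁.continuousOn.mul H₂.continuousOn, by simpa using H₁.bounded.mul H₂.bounded, ?_⟩
  obtain ⟨φ₁, hφ₁, e₁⟩ := H₁.analytic
  obtain ⟨φ₂, hφ₂, e₂⟩ := H₂.analytic
  refine ⟨fun t => φ₁ t * φ₂ t, hφ₁.mul hφ₂, ?_⟩
  filter_upwards [e₁, e₂] with t h1 h2
  rw [← h1, ← h2]
  ring

lemma analyticAt_cexp_neg_mul (c : ℝ) : AnalyticAt ℝ (fun t : ℝ => Complex.exp (-(c * t))) 0 :=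
  (analyticAt_cexp.restrictScalars (𝕜 := ℝ)).comp
    (analyticAt_const.mul (Complex.ofRealCLM.analyticAt 0)).neg

lemma tendsto_cexp_neg_mul_atTop {c : ℝ} (hc : 0 < c) :
    Tendsto (fun t : ℝ => Complex.exp (-(c * t))) atTop (𝓝 0) := by
  have h1 : Tendsto (fun t : ℝ => Real.exp (-(c * t))) atTop (𝓝 0) :=
    Real.tendsto_exp_neg_atTop_nhds_zero.comp (tendsto_id.const_mul_atTop hc)
  have h2 := (Complex.continuous_ofReal.tendsto 0).comp h1
  refine (h2.congr fun t => ?_).trans (by simp)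
  simp

lemma one_sub_cexp_ne_zero {c t : ℝ} (hc : 0 < c) (ht : 0 < t) :
    1 - Complex.exp (-(c * t)) ≠ 0 := by
  have h1 : Real.exp (-(c * t)) < 1 := Real.exp_lt_one_iff.2 (by nlinarith)
  intro h
  have h2 : Complex.exp (-(c * t)) = (Real.exp (-(c * t)) : ℝ) := by push_cast; rfl
  rw [h2, sub_eq_zero] at h
  have h3 : (1 : ℝ) = Real.exp (-(c * t)) := by exact_mod_cast h
  linarith

/-- `1 / (1 - e ^ (-c t))` has a simple pole at `0`. -/
lemma hasPoleExpansion_inv_one_sub_cexp {c : ℝ} (hc : 0 < c) :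
    HasPoleExpansion (fun t => (1 - Complex.exp (-(c * t)))⁻¹) 1 := by
  refine ⟨?_, ?_, ?_⟩
  · exact ContinuousOn.inv₀ (by fun_prop) fun t ht => one_sub_cexp_ne_zero hc ht
  · have := (tendsto_const_nhds (x := (1 : ℂ))).sub (tendsto_cexp_neg_mul_atTop hc)
    exact (this.inv₀ (by simp)).isBigO_one ℝ
  · set f : ℝ → ℂ := fun t => 1 - Complex.exp (-(c * t)) with hf
    have hfa : AnalyticAt ℝ f 0 := analyticAt_const.sub (analyticAt_cexp_neg_mul c)
    obtain ⟨p, hp⟩ := hfa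
    have hd : HasDerivAt f c 0 := by
      have h1 : HasDerivAt (fun t : ℝ => -((c : ℂ) * (t : ℂ))) (-(c * 1)) 0 :=
        ((Complex.ofRealCLM.hasDerivAt (x := (0 : ℝ))).const_mul (c : ℂ)).neg
      convert! h1.cexp.const_sub 1 using 1
      simp
    have hs : AnalyticAt ℝ (dslope f 0) 0 := ⟨_, hp.has_fpower_series_dslope_fslope⟩
    refine ⟨fun t => (dslope f 0 t)⁻¹, hs.inv ?_, ?_⟩
    · rw [dslope_same, hd.deriv]
      exact_mod_cast hc.ne'
    · filter_upwards [self_mem_nhdsWithin] with t (ht : 0 < t)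
      rw [dslope_of_ne _ ht.ne', slope_def_module]
      simp [hf, mul_comm]

/-- `1 / (1 + e ^ (-c t))` is regular at `0`. -/
lemma hasPoleExpansion_inv_one_add_cexp {c : ℝ} (hc : 0 < c) :
    HasPoleExpansion (fun t => (1 + Complex.exp (-(c * t)))⁻¹) 0 := by
  refine ⟨?_, ?_, ?_⟩
  · refine ContinuousOn.inv₀ (by fun_prop) fun t _ => ?_
    have h2 : 1 + Complex.exp (-(c * t)) = ((1 + Real.exp (-(c * t)) : ℝ) : ℂ) := by push_cast; rfl
    rw [h2]
    exact_mod_cast (by positivity : 1 + Real.exp (-(c * t)) ≠ 0)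
  · have := (tendsto_const_nhds (x := (1 : ℂ))).add (tendsto_cexp_neg_mul_atTop hc)
    exact (this.inv₀ (by simp)).isBigO_one ℝ
  · refine ⟨fun t => (1 + Complex.exp (-(c * t)))⁻¹,
      (analyticAt_const.add (analyticAt_cexp_neg_mul c)).inv (by norm_num), ?_⟩
    exact Eventually.of_forall fun t => by simp

/-- The generating function `∑ e ^ (-(n₁ ω₁ + ⋯ + n_r ω_r) t) = ∏ 1 / (1 - e ^ (-ω_i t))`. -/
noncomputable def coneSum {r : ℕ} (ω : Fin r → ℝ) (t : ℝ) : ℝ := ∏ i, (1 - Real.exp (-(ω i * t)))⁻¹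

lemma ofReal_coneSum {r : ℕ} (ω : Fin r → ℝ) (t : ℝ) :
    (coneSum ω t : ℂ) = ∏ i, (1 - Complex.exp (-(ω i * t)))⁻¹ := by
  simp [coneSum]

lemma hasPoleExpansion_coneSum {r : ℕ} {ω : Fin r → ℝ} (hω : ∀ i, 0 < ω i) :
    HasPoleExpansion (fun t => (coneSum ω t : ℂ)) r := by
  simp only [ofReal_coneSum]
  have : ∀ s : Finset (Fin r), HasPoleExpansion
      (fun t : ℝ => ∏ i ∈ s, (1 - Complex.exp (-((ω i : ℂ) * t)))⁻¹) s.card := by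
    intro s
    induction s using Finset.induction_on with
    | empty =>
      refine ⟨continuousOn_const, isBigO_of_le _ fun t => by simp, fun _ => 1, analyticAt_const, ?_⟩
      exact Eventually.of_forall fun t => by simp
    | insert i s hi ih =>
      simp only [Finset.prod_insert hi, Finset.card_insert_of_notMem hi, add_comm s.card 1]
      exact (hasPoleExpansion_inv_one_sub_cexp (hω i)).mul ih
  simpa using this Finset.univ

lemma hasSum_coneSum {r : ℕ} {ω : Fin r → ℝ} (hω : ∀ i, 0 < ω i) {t : ℝ} (ht : 0 < t) :
    HasSum (fun n : Fin r → ℕ => Real.exp (-((∑ i, (n i : ℝ) * ω i) * t))) (coneSum ω t) := by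
  induction r with
  | zero => simp [coneSum]
  | succ r ih =>
    have h1 := ih (ω := fun i => ω i.succ) fun i => hω _
    have hlt : Real.exp (-(ω 0 * t)) < 1 := Real.exp_lt_one_iff.2 (by nlinarith [mul_pos (hω 0) ht])
    have h2 := hasSum_geometric_of_lt_one (Real.exp_pos (-(ω 0 * t))).le hlt
    have h3 := h2.mul h1 (h2.summable.mul_of_nonneg h1.summable
      (fun _ => by positivity) fun _ => by positivity)
    rw [← (Fin.consEquiv fun _ : Fin (r + 1) => ℕ).hasSum_iff]
    convert! h3 using 1
    · funext p
      simp only [Function.comp_apply, Fin.consEquiv_apply, Fin.sum_univ_succ, Fin.cons_zero,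
        Fin.cons_succ]
      rw [← Real.exp_nat_mul, ← Real.exp_add]
      ring_nf
    · rw [coneSum, Fin.prod_univ_succ, coneSum]

lemma linForm_eq {r : ℕ} (ω : Fin r → ℝ) (x : ℂ) (n : Fin r → ℕ) :
    linForm ω x n = ((∑ i, (n i : ℝ) * ω i : ℝ) : ℂ) + x := by
  simp [linForm]

lemma not_isGammaPole_iff {r : ℕ} {ω : Fin r → ℝ} {x : ℂ} :
    ¬ IsGammaPole ω x ↔ ∀ n : Fin r → ℕ, ((∑ i, (n i : ℝ) * ω i : ℝ) : ℂ) + x ≠ 0 := by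
  simp only [IsGammaPole, linForm_eq, not_exists, ne_eq]

lemma not_isGammaPole_of_re_pos {r : ℕ} {ω : Fin r → ℝ} (hω : ∀ i, 0 < ω i) {x : ℂ}
    (hx : 0 < x.re) : ¬ IsGammaPole ω x := by
  rw [not_isGammaPole_iff]
  intro n h
  have h1 := congrArg Complex.re h
  have h2 : 0 ≤ ∑ i, (n i : ℝ) * ω i :=
    Finset.sum_nonneg fun i _ => mul_nonneg (Nat.cast_nonneg _) (hω i).le
  simp only [Complex.add_re, Complex.ofReal_re, Complex.zero_re] at h1
  linarith

section

variable {r : ℕ} {ω : Fin r → ℝ}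

/-- The continuation of the multiple Hurwitz zeta function, and the shape of the multiple gamma
function in the half-plane `re x > -M`. -/
lemma multHurwitz_and_multGamma (hω : ∀ i, 0 < ω i) (M : ℝ) :
    ∃ (S : Finset (Fin r → ℕ)) (g : ℂ → ℂ), DifferentiableOn ℂ g {x | -M < x.re} ∧
      ∀ x : ℂ, -M < x.re → ¬ IsGammaPole ω x →
        IsContinuationFrom r (MultHurwitzConverges ω x) (multHurwitzSeries ω x)
          (fun w => multHurwitz w x ω) ∧
        (∀ w, polePoly r w ≠ 0 → AnalyticAt ℂ (fun w => multHurwitz w x ω) w) ∧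
        multGamma x ω = (∏ n ∈ S, (linForm ω x n)⁻¹) * Complex.exp (g x) := by
  obtain ⟨S, g, hg, h⟩ := exists_entire_dirichlet (fun t ht => hasSum_coneSum hω ht)
    (hasPoleExpansion_coneSum hω) M
  refine ⟨S, g, hg, fun x hx hne => ?_⟩
  obtain ⟨E, hE, hsum, hexp⟩ := h x hx (not_isGammaPole_iff.1 hne)
  simp only [← linForm_eq] at hsum hexp
  have hc := isContinuationFrom_of_entire (P := MultHurwitzConverges ω x)
    (g := multHurwitzSeries ω x) hE fun w hw => ⟨(hsum w hw).summable, (hsum w hw).tsum_eq⟩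
  refine ⟨hc.1, fun w hw => (analyticAt_div_polePoly hE hw).congr (hc.2 w hw).symm, ?_⟩
  rw [← hexp, multGamma]
  exact congrArg Complex.exp (hc.2 0 (polePoly_zero_ne_zero r)).deriv_eq

lemma isContinuationFrom_multHurwitz (hω : ∀ i, 0 < ω i) {x : ℂ} (hx : ¬ IsGammaPole ω x) :
    IsContinuationFrom r (MultHurwitzConverges ω x) (multHurwitzSeries ω x)
      (fun w => multHurwitz w x ω) := by
  obtain ⟨S, g, -, h⟩ := multHurwitz_and_multGamma hω (1 - x.re)
  exact (h x (by linarith) hx).1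

lemma analyticAt_multHurwitz (hω : ∀ i, 0 < ω i) {x : ℂ} (hx : ¬ IsGammaPole ω x) {w : ℂ}
    (hw : polePoly r w ≠ 0) : AnalyticAt ℂ (fun w => multHurwitz w x ω) w := by
  obtain ⟨S, g, -, h⟩ := multHurwitz_and_multGamma hω (1 - x.re)
  exact (h x (by linarith) hx).2.1 w hw

/-- The multiple Hurwitz zeta function as a Mellin transform, for `re x > 0`. -/
lemma multHurwitz_eq_mellin (hω : ∀ i, 0 < ω i) {x w : ℂ} (hx : 0 < x.re) (hw : r < w.re) :
    MellinConvergent (fun t : ℝ => (coneSum ω t : ℂ) * Complex.exp (-(x * t))) w ∧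
    multHurwitz w x ω = (Complex.Gamma w)⁻¹ *
      mellin (fun t : ℝ => (coneSum ω t : ℂ) * Complex.exp (-(x * t))) w := by
  have h0 : 0 < w.re := (Nat.cast_nonneg r).trans_lt hw
  obtain ⟨E, hE, -⟩ := (hasPoleExpansion_coneSum hω).exists_entire
  have hconv := ((hE x hx).2 w hw).1
  have h1 := hasSum_cpow_neg_of_hasSum_exp
    (lam := fun n : Fin r → ℕ => ∑ i, (n i : ℝ) * ω i)
    (fun n => Finset.sum_nonneg fun i _ => mul_nonneg (Nat.cast_nonneg _) (hω i).le)
    (fun t ht => hasSum_coneSum hω ht) hx h0 hconv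
  simp only [← linForm_eq] at h1
  refine ⟨hconv, ?_⟩
  rw [((isContinuationFrom_multHurwitz hω (not_isGammaPole_of_re_pos hω hx)).eq_of_lt_re w hw).2,
    multHurwitzSeries, h1.tsum_eq]

lemma multGamma_ne_zero (x : ℂ) : multGamma x ω ≠ 0 := Complex.exp_ne_zero _

lemma isOpen_lt_re (c : ℝ) : IsOpen {x : ℂ | c < x.re} :=
  isOpen_lt continuous_const Complex.continuous_re

/-- The points `-(n₁ ω₁ + ⋯ + n_r ω_r)` form a closed discrete set. -/
lemma eventually_not_isGammaPole (hω : ∀ i, 0 < ω i) (x₀ : ℂ) :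
    ∀ᶠ x in 𝓝[≠] x₀, ¬ IsGammaPole ω x := by
  have hfin : {n : Fin r → ℕ | ∑ i, (n i : ℝ) * ω i ≤ 1 - x₀.re}.Finite :=
    finite_setOf_le_of_summable_exp (hasSum_coneSum hω one_pos).summable _
  set T : Set ℂ := (fun n : Fin r → ℕ => -((∑ i, (n i : ℝ) * ω i : ℝ) : ℂ)) ''
    {n | ∑ i, (n i : ℝ) * ω i ≤ 1 - x₀.re} with hT
  have hT' : (T \ {x₀}).Finite := (hfin.image _).subset sdiff_subset
  have h1 : ∀ᶠ x in 𝓝[≠] x₀, x ∉ T := by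
    have := hT'.isClosed.isOpen_compl.mem_nhds (x := x₀) (by simp)
    filter_upwards [mem_nhdsWithin_of_mem_nhds this, self_mem_nhdsWithin] with x hx hne hmem
    exact hx ⟨hmem, hne⟩
  have h2 : ∀ᶠ x : ℂ in 𝓝[≠] x₀, x₀.re - 1 < x.re :=
    mem_nhdsWithin_of_mem_nhds ((isOpen_lt_re (x₀.re - 1)).mem_nhds (by simp))
  filter_upwards [h1, h2] with x hx hre
  rw [not_isGammaPole_iff]
  intro n hn
  refine hx ⟨n, ?_, (eq_neg_of_add_eq_zero_right hn).symm⟩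
  have := congrArg Complex.re hn
  simp only [Complex.add_re, Complex.ofReal_re, Complex.zero_re] at this
  change ∑ i, (n i : ℝ) * ω i ≤ 1 - x₀.re
  linarith

lemma meromorphicAt_multGamma (hω : ∀ i, 0 < ω i) (x₀ : ℂ) :
    MeromorphicAt (fun x => multGamma x ω) x₀ := by
  obtain ⟨S, g, hg, h⟩ := multHurwitz_and_multGamma hω (1 - x₀.re)
  have hmem : {x : ℂ | -(1 - x₀.re) < x.re} ∈ 𝓝 x₀ := (isOpen_lt_re _).mem_nhds (by simp)
  have hga : AnalyticAt ℂ g x₀ := hg.analyticAt hmem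
  have hl : ∀ n, AnalyticAt ℂ (fun x => linForm ω x n) x₀ := fun n =>
    analyticAt_const.add analyticAt_id
  have hm : MeromorphicAt (fun x => (∏ n ∈ S, (linForm ω x n)⁻¹) * Complex.exp (g x)) x₀ :=
    (MeromorphicAt.fun_prod fun n _ => (hl n).meromorphicAt.inv).mul hga.cexp.meromorphicAt
  refine hm.congr ?_
  filter_upwards [mem_nhdsWithin_of_mem_nhds hmem, eventually_not_isGammaPole hω x₀] with x hx hne
  exact (h x hx hne).2.2.symm

lemma analyticAt_multGamma (hω : ∀ i, 0 < ω i) {x₀ : ℂ} (hx₀ : ¬ IsGammaPole ω x₀) :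
    AnalyticAt ℂ (fun x => multGamma x ω) x₀ := by
  obtain ⟨S, g, hg, h⟩ := multHurwitz_and_multGamma hω (1 - x₀.re)
  have hmem : {x : ℂ | -(1 - x₀.re) < x.re} ∈ 𝓝 x₀ := (isOpen_lt_re _).mem_nhds (by simp)
  have hga : AnalyticAt ℂ g x₀ := hg.analyticAt hmem
  have hl : ∀ n, AnalyticAt ℂ (fun x => (linForm ω x n)⁻¹) x₀ := fun n =>
    (analyticAt_const.add analyticAt_id).inv fun h0 => hx₀ ⟨n, h0⟩
  have ha : AnalyticAt ℂ (fun x => (∏ n ∈ S, (linForm ω x n)⁻¹) * Complex.exp (g x)) x₀ :=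
    (Finset.analyticAt_fun_prod _ fun n _ => hl n).mul hga.cexp
  have hev : ∀ᶠ x in 𝓝 x₀, ¬ IsGammaPole ω x := by
    have := eventually_nhdsWithin_iff.1 (eventually_not_isGammaPole hω x₀)
    filter_upwards [this] with x hx
    by_cases hxx : x = x₀
    · rwa [hxx]
    · exact hx hxx
  refine ha.congr ?_
  filter_upwards [hmem, hev] with x hx hne
  exact (h x hx hne).2.2.symm

end

/-! ### Absolute Hurwitz zeta functions and absolute zeta functions -/

lemma exp_image_Ioi_zero : Real.exp '' Ioi 0 = Ioi 1 := by
  ext x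
  constructor
  · rintro ⟨t, ht, rfl⟩
    exact Real.one_lt_exp_iff.2 ht
  · intro (hx : 1 < x)
    exact ⟨Real.log x, Real.log_pos hx, Real.exp_log (by linarith)⟩

/-- The substitution `x = e ^ t` turns the integral defining the absolute Hurwitz zeta function of
`f` into a Mellin transform. -/
lemma absHurwitz_eq_mellin {f : ℝ → OnePoint ℂ} {h : ℝ → ℂ} {N : ℂ}
    (hf : ∀ t : ℝ, 0 < t → f (Real.exp t) = ((Complex.exp (-(N * t)) * h t : ℂ) : OnePoint ℂ))
    (s w : ℂ) :
    (AbsHurwitzConverges f s w ↔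
      MellinConvergent (fun t : ℝ => h t * Complex.exp (-((s + N) * t))) w) ∧
    absHurwitzIntegral f s w = (Complex.Gamma w)⁻¹ *
      mellin (fun t : ℝ => h t * Complex.exp (-((s + N) * t))) w := by
  have hderiv : ∀ t ∈ Ioi (0 : ℝ), HasDerivWithinAt Real.exp (Real.exp t) (Ioi 0) t := fun t _ =>
    (Real.hasDerivAt_exp t).hasDerivWithinAt
  have hcongr : EqOn (fun t => |Real.exp t| • absHurwitzIntegrand f w s (Real.exp t))
      (fun t : ℝ => (t : ℂ) ^ (w - 1) • (h t * Complex.exp (-((s + N) * t)))) (Ioi 0) := by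
    intro t ht
    have h1 : ((Real.exp t : ℝ) : ℂ) ^ (-s - 1) = Complex.exp (t * (-s - 1)) := by
      rw [Complex.cpow_def_of_ne_zero (by exact_mod_cast (Real.exp_pos t).ne'),
        ← Complex.ofReal_log (Real.exp_pos t).le, Real.log_exp]
    have h2 : finiteValue (f (Real.exp t)) = Complex.exp (-(N * t)) * h t := by
      rw [hf t ht]
      rfl
    simp only [absHurwitzIntegrand, h1, h2, Real.log_exp, abs_of_pos (Real.exp_pos t),
      Complex.real_smul, smul_eq_mul]
    have h3 : Complex.exp (-((s + N) * t)) =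
        Complex.exp t * (Complex.exp (-(N * t)) * Complex.exp (t * (-s - 1))) := by
      rw [← Complex.exp_add, ← Complex.exp_add]
      ring_nf
    rw [h3, Complex.ofReal_exp]
    ring
  refine ⟨⟨fun hc => ?_, fun hc => ⟨?_, ?_⟩⟩, ?_⟩
  · have h1 := hc.2
    rw [← exp_image_Ioi_zero, integrableOn_image_iff_integrableOn_abs_deriv_smul measurableSet_Ioi
      hderiv Real.exp_injective.injOn] at h1
    exact (integrableOn_congr_fun hcongr measurableSet_Ioi).1 h1
  · refine (ae_restrict_iff' measurableSet_Ioi).2 (Eventually.of_forall fun x (hx : 1 < x) => ?_)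
    rw [← Real.exp_log (by linarith : 0 < x), hf _ (Real.log_pos hx)]
    exact OnePoint.coe_ne_infty _
  · rw [← exp_image_Ioi_zero, integrableOn_image_iff_integrableOn_abs_deriv_smul measurableSet_Ioi
      hderiv Real.exp_injective.injOn]
    exact (integrableOn_congr_fun hcongr measurableSet_Ioi).2 hc
  · rw [absHurwitzIntegral, one_div, ← exp_image_Ioi_zero,
      integral_image_eq_integral_abs_deriv_smul measurableSet_Ioi hderiv Real.exp_injective.injOn,
      setIntegral_congr_fun measurableSet_Ioi hcongr, mellin]

section

variable {f : ℝ → OnePoint ℂ} {n r : ℕ} {ω : Fin n → ℝ} {ε : ℤ}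

/-- If `f(e ^ t) = ε e ^ (-9 t) (1 - e ^ (-t)) ∏ 1 / (1 - e ^ (-ω_i t))`, with a pole of order `r` at
`t = 0`, then `Z_f(w, s) = ε (ζ_n(w, s + 9, ω) - ζ_n(w, s + 10, ω))`. -/
lemma absHurwitz_continuation (hω : ∀ i, 0 < ω i)
    (hf : ∀ t : ℝ, 0 < t → f (Real.exp t) = ((Complex.exp (-(9 * t)) *
      (ε * ((1 - Complex.exp (-t)) * coneSum ω t)) : ℂ) : OnePoint ℂ))
    (hpole : HasPoleExpansion (fun t : ℝ => ε * ((1 - Complex.exp (-t)) * coneSum ω t)) r)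
    {s : ℂ} (hs : -9 < s.re) :
    IsContinuationFrom r (AbsHurwitzConverges f s) (absHurwitzIntegral f s)
      (fun w => absHurwitz f w s) ∧
    AnalyticAt ℂ (fun w => absHurwitz f w s) 0 ∧
    ∀ w, polePoly n w ≠ 0 → (fun w => absHurwitz f w s) =ᶠ[𝓝 w] fun w =>
      ε * (multHurwitz w (s + 9) ω - multHurwitz w (s + 10) ω) := by
  have h9 : 0 < (s + 9).re := by simp; linarith
  have h10 : 0 < (s + 10).re := by simp; linarith
  have hsub := absHurwitz_eq_mellin hf s
  obtain ⟨E, hE, -⟩ := hpole.exists_entire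
  obtain ⟨hEd, hEw⟩ := hE _ h9
  have hc := isContinuationFrom_of_entire (P := AbsHurwitzConverges f s)
    (g := absHurwitzIntegral f s) hEd fun w hw =>
      ⟨(hsub w).1.2 (hEw w hw).1, (hsub w).2.trans (hEw w hw).2⟩
  refine ⟨hc.1, (analyticAt_div_polePoly hEd (polePoly_zero_ne_zero r)).congr
    (hc.2 0 (polePoly_zero_ne_zero r)).symm, ?_⟩
  have hg9 := not_isGammaPole_of_re_pos hω h9
  have hg10 := not_isGammaPole_of_re_pos hω h10
  have han : ∀ w, polePoly n w ≠ 0 → AnalyticAt ℂ (fun w =>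
      ε * (multHurwitz w (s + 9) ω - multHurwitz w (s + 10) ω)) w := fun w hw =>
    analyticAt_const.mul ((analyticAt_multHurwitz hω hg9 hw).sub (analyticAt_multHurwitz hω hg10 hw))
  have hmer : MeromorphicOn (fun w => ε * (multHurwitz w (s + 9) ω - multHurwitz w (s + 10) ω))
      univ := fun w _ => analyticAt_const.meromorphicAt.mul
    (((isContinuationFrom_multHurwitz hω hg9).meromorphic (mem_univ w)).meromorphicAt.sub
      ((isContinuationFrom_multHurwitz hω hg10).meromorphic (mem_univ w)).meromorphicAt)
  -- in the half-plane `re w > max n r` both sides are given by the same Mellin transform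
  have hc' := isContinuationFrom_continuation (σ := max n r) (P := AbsHurwitzConverges f s)
    (g := absHurwitzIntegral f s) hmer fun w hw => by
      have hwn : (n : ℝ) < w.re := (le_max_left _ _).trans_lt hw
      have hwr : (r : ℝ) < w.re := (le_max_right _ _).trans_lt hw
      refine ⟨han w (polePoly_ne_zero_of_lt_re hwn), (hsub w).1.2 (hEw w hwr).1, ?_⟩
      obtain ⟨c9, e9⟩ := multHurwitz_eq_mellin hω h9 hwn
      obtain ⟨c10, e10⟩ := multHurwitz_eq_mellin hω h10 hwn
      have h1 := (hasMellin_sub c9 c10).2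
      have h2 := mellin_const_smul (fun t : ℝ => (coneSum ω t : ℂ) * Complex.exp (-((s + 9) * t)) -
        (coneSum ω t : ℂ) * Complex.exp (-((s + 10) * t))) w (ε : ℂ)
      have h3 : (fun t : ℝ => ε * ((1 - Complex.exp (-t)) * coneSum ω t) *
          Complex.exp (-((s + 9) * t))) = fun t : ℝ => (ε : ℂ) •
          ((coneSum ω t : ℂ) * Complex.exp (-((s + 9) * t)) -
            (coneSum ω t : ℂ) * Complex.exp (-((s + 10) * t))) := by
        funext t
        have : Complex.exp (-((s + 10) * t)) =
            Complex.exp (-t) * Complex.exp (-((s + 9) * t)) := by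
          rw [← Complex.exp_add]
          ring_nf
        rw [this, smul_eq_mul]
        ring
      rw [(hsub w).2, h3, h2, h1, e9, e10, smul_eq_mul]
      ring
  exact fun w hw => hc'.2 w (han w hw)

/-- In the same situation, `ζ_f(s) = (Γ_n(s + 9, ω) / Γ_n(s + 10, ω)) ^ ε`. -/
lemma absZeta_continuation (hω : ∀ i, 0 < ω i)
    (hf : ∀ t : ℝ, 0 < t → f (Real.exp t) = ((Complex.exp (-(9 * t)) *
      (ε * ((1 - Complex.exp (-t)) * coneSum ω t)) : ℂ) : OnePoint ℂ))
    (hpole : HasPoleExpansion (fun t : ℝ => ε * ((1 - Complex.exp (-t)) * coneSum ω t)) r) :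
    IsContinuationFrom (-9) (AbsZetaDefined f) (absZetaExp f) (absZeta f) ∧
    ∀ s : ℂ, ¬ IsGammaPole ω (s + 9) → ¬ IsGammaPole ω (s + 10) →
      absZeta f s = (multGamma (s + 9) ω / multGamma (s + 10) ω) ^ ε := by
  have han : ∀ s : ℂ, ¬ IsGammaPole ω (s + 9) → ¬ IsGammaPole ω (s + 10) →
      AnalyticAt ℂ (fun s => (multGamma (s + 9) ω / multGamma (s + 10) ω) ^ ε) s :=
    fun s h9 h10 => by
      have h1 : AnalyticAt ℂ (fun s => multGamma (s + 9) ω) s :=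
        (analyticAt_multGamma hω h9).comp (f := fun s : ℂ => s + 9)
          (analyticAt_id.add analyticAt_const)
      have h2 : AnalyticAt ℂ (fun s => multGamma (s + 10) ω) s :=
        (analyticAt_multGamma hω h10).comp (f := fun s : ℂ => s + 10)
          (analyticAt_id.add analyticAt_const)
      exact (h1.div h2 (multGamma_ne_zero _)).zpow
        (div_ne_zero (multGamma_ne_zero _) (multGamma_ne_zero _))
  have hmer : MeromorphicOn (fun s => (multGamma (s + 9) ω / multGamma (s + 10) ω) ^ ε) univ := by
    intro s _
    have h1 : ∀ c : ℂ, MeromorphicAt (fun s => multGamma (s + c) ω) s := fun c =>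
      (meromorphicAt_multGamma hω (s + c)).comp_analyticAt (g := fun s : ℂ => s + c)
        (analyticAt_id.add analyticAt_const)
    exact ((h1 9).div (h1 10)).zpow ε
  have hc := isContinuationFrom_continuation (σ := -9) (P := AbsZetaDefined f) (g := absZetaExp f)
    hmer fun s hs => by
      have hg9 := not_isGammaPole_of_re_pos hω (x := s + 9) (by simp; linarith)
      have hg10 := not_isGammaPole_of_re_pos hω (x := s + 10) (by simp; linarith)
      obtain ⟨h1, h2, h3⟩ := absHurwitz_continuation hω hf hpole hs
      refine ⟨han s hg9 hg10, ⟨⟨r, h1⟩, h2⟩, ?_⟩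
      have hp := polePoly_zero_ne_zero n
      have hd : deriv (fun w => absHurwitz f w s) 0 = ε *
          (deriv (fun w => multHurwitz w (s + 9) ω) 0 -
            deriv (fun w => multHurwitz w (s + 10) ω) 0) := by
        rw [(h3 0 hp).deriv_eq]
        exact (((analyticAt_multHurwitz hω hg9 hp).differentiableAt.hasDerivAt.sub
          (analyticAt_multHurwitz hω hg10 hp).differentiableAt.hasDerivAt).const_mul _).deriv
      rw [absZetaExp, hd, Complex.exp_int_mul, Complex.exp_sub]
      rfl
  exact ⟨hc.1, fun s h9 h10 => (hc.2 s (han s h9 h10)).eq_of_nhds⟩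

end

/-! ### The absolute zeta functions of the Grover walks -/

lemma HasPoleExpansion.congr {h₁ h₂ : ℝ → ℂ} {r : ℕ} (H : HasPoleExpansion h₁ r)
    (h : ∀ t : ℝ, 0 < t → h₁ t = h₂ t) : HasPoleExpansion h₂ r := by
  refine ⟨H.continuousOn.congr fun t ht => (h t ht).symm, H.bounded.congr' ?_ EventuallyEq.rfl, ?_⟩
  · filter_upwards [eventually_gt_atTop 0] with t ht using h t ht
  · obtain ⟨φ, hφ, hev⟩ := H.analytic
    refine ⟨φ, hφ, ?_⟩
    filter_upwards [hev, self_mem_nhdsWithin] with t h1 h2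
    rw [← h t h2, h1]

lemma hasPoleExpansion_const (c : ℂ) : HasPoleExpansion (fun _ => c) 0 :=
  ⟨continuousOn_const, isBigO_const_const _ one_ne_zero _, fun _ => c, analyticAt_const,
    Eventually.of_forall fun t => by simp⟩

lemma walkZeta_eq_of_det_mul_eq_one {N : ℕ} [NeZero N] {A : Matrix (Fin 3) (Fin 3) ℂ} {u z : ℂ}
    (h : (1 - u • evolutionOp N A).det * z = 1) : walkZeta N A u = (z : OnePoint ℂ) := by
  rw [walkZeta, if_neg (left_ne_zero_of_mul_eq_one h), eq_inv_of_mul_eq_one_right h]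

lemma cexp_neg_pow (t : ℝ) (k : ℕ) : Complex.exp (-t) ^ k = Complex.exp (-(k * t)) := by
  rw [← Complex.exp_nat_mul]
  ring_nf

lemma coneSum_two_two_three_three (t : ℝ) : (coneSum ![2, 2, 3, 3] t : ℂ) =
    ((1 - Complex.exp (-t) ^ 2)⁻¹) ^ 2 * ((1 - Complex.exp (-t) ^ 3)⁻¹) ^ 2 := by
  rw [ofReal_coneSum, cexp_neg_pow, cexp_neg_pow, Fin.prod_univ_four]
  simp [-inv_pow]
  ring

lemma coneSum_two_four_four (t : ℝ) : (coneSum ![2, 4, 4] t : ℂ) =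
    (1 - Complex.exp (-t) ^ 2)⁻¹ * ((1 - Complex.exp (-t) ^ 4)⁻¹) ^ 2 := by
  rw [ofReal_coneSum, cexp_neg_pow, cexp_neg_pow, Fin.prod_univ_three]
  simp [-inv_pow]
  ring

lemma one_sub_cexp_pow_ne_zero {k : ℕ} (hk : 0 < k) {t : ℝ} (ht : 0 < t) :
    1 - Complex.exp (-t) ^ k ≠ 0 := by
  have h := one_sub_cexp_ne_zero (c := k) (by exact_mod_cast hk) ht
  rw [cexp_neg_pow]
  exact_mod_cast h

lemma one_add_cexp_ne_zero {t : ℝ} (ht : 0 < t) : 1 + Complex.exp (-t) ≠ 0 := by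
  have h := one_sub_cexp_pow_ne_zero (k := 2) two_pos ht
  intro h0
  apply h
  linear_combination (1 - Complex.exp (-t)) * h0

lemma groverZetaM_exp {t : ℝ} (ht : 0 < t) : groverZetaM (Real.exp t) =
    ((Complex.exp (-(9 * t)) * (((-1 : ℤ) : ℂ) *
      ((1 - Complex.exp (-t)) * coneSum ![2, 2, 3, 3] t)) : ℂ) : OnePoint ℂ) := by
  refine walkZeta_eq_of_det_mul_eq_one ?_
  have e : Complex.exp (-(9 * t)) = Complex.exp (-t) ^ 9 := by exact_mod_cast (cexp_neg_pow t 9).symm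
  have e' : ((Real.exp t : ℝ) : ℂ) = (Complex.exp (-t))⁻¹ := by
    rw [Complex.exp_neg, inv_inv, Complex.ofReal_exp]
  have h2 := one_sub_cexp_pow_ne_zero (k := 2) two_pos ht
  have h3 := one_sub_cexp_pow_ne_zero (k := 3) three_pos ht
  have h0 := Complex.exp_ne_zero (-t)
  rw [det_evolutionOp_groverCoinM, coneSum_two_two_three_three, e, e']
  generalize Complex.exp (-t) = q at *
  field_simp
  push_cast
  ring

lemma groverZetaF_exp {t : ℝ} (ht : 0 < t) : groverZetaF (Real.exp t) =
    ((Complex.exp (-(9 * t)) * (((1 : ℤ) : ℂ) *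
      ((1 - Complex.exp (-t)) * coneSum ![2, 4, 4] t)) : ℂ) : OnePoint ℂ) := by
  refine walkZeta_eq_of_det_mul_eq_one ?_
  have e : Complex.exp (-(9 * t)) = Complex.exp (-t) ^ 9 := by exact_mod_cast (cexp_neg_pow t 9).symm
  have e' : ((Real.exp t : ℝ) : ℂ) = (Complex.exp (-t))⁻¹ := by
    rw [Complex.exp_neg, inv_inv, Complex.ofReal_exp]
  have h2 := one_sub_cexp_pow_ne_zero (k := 2) two_pos ht
  have h3 := one_sub_cexp_pow_ne_zero (k := 4) four_pos ht
  have h0 := Complex.exp_ne_zero (-t)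
  rw [det_evolutionOp_groverCoinF, coneSum_two_four_four, e, e']
  generalize Complex.exp (-t) = q at *
  field_simp
  push_cast
  ring

/-- The numerator `1 - e ^ (-t)` cancels one of the four poles at `t = 0`. -/
lemma hasPoleExpansion_groverM : HasPoleExpansion (fun t : ℝ => ((-1 : ℤ) : ℂ) *
    ((1 - Complex.exp (-t)) * coneSum ![2, 2, 3, 3] t)) 3 := by
  have h1 := hasPoleExpansion_inv_one_add_cexp one_pos
  have h2 := hasPoleExpansion_inv_one_sub_cexp two_pos
  have h3 := hasPoleExpansion_inv_one_sub_cexp three_pos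
  refine ((hasPoleExpansion_const (-1)).mul (h1.mul (h2.mul (h3.mul h3)))).congr fun t ht => ?_
  have k1 := one_add_cexp_ne_zero ht
  have k2 := one_sub_cexp_pow_ne_zero (k := 2) two_pos ht
  have k3 := one_sub_cexp_pow_ne_zero (k := 3) three_pos ht
  have e2 : Complex.exp (-((2 : ℝ) * t)) = Complex.exp (-t) ^ 2 := by
    exact_mod_cast (cexp_neg_pow t 2).symm
  have e3 : Complex.exp (-((3 : ℝ) * t)) = Complex.exp (-t) ^ 3 := by
    exact_mod_cast (cexp_neg_pow t 3).symm
  rw [coneSum_two_two_three_three, e2, e3, Complex.ofReal_one, one_mul]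
  generalize Complex.exp (-t) = q at *
  field_simp
  push_cast
  ring

/-- The numerator `1 - e ^ (-t)` cancels one of the three poles at `t = 0`. -/
lemma hasPoleExpansion_groverF : HasPoleExpansion (fun t : ℝ => ((1 : ℤ) : ℂ) *
    ((1 - Complex.exp (-t)) * coneSum ![2, 4, 4] t)) 2 := by
  have h1 := hasPoleExpansion_inv_one_add_cexp one_pos
  have h4 := hasPoleExpansion_inv_one_sub_cexp four_pos
  refine (h1.mul (h4.mul h4)).congr fun t ht => ?_
  have k1 := one_add_cexp_ne_zero ht
  have k2 := one_sub_cexp_pow_ne_zero (k := 2) two_pos ht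
  have k4 := one_sub_cexp_pow_ne_zero (k := 4) four_pos ht
  have e4 : Complex.exp (-((4 : ℝ) * t)) = Complex.exp (-t) ^ 4 := by
    exact_mod_cast (cexp_neg_pow t 4).symm
  rw [coneSum_two_four_four, e4, Complex.ofReal_one, one_mul]
  generalize Complex.exp (-t) = q at *
  field_simp
  push_cast
  ring

lemma sum_powerset_singleton {M : Type*} [AddCommMonoid M] (g : ℕ → M) :
    ∑ I ∈ ({1} : Finset ℕ).powerset, g I.card = g 0 + g 1 := by
  rw [show ({1} : Finset ℕ).powerset = {∅, {1}} from rfl, Finset.sum_pair (by decide)]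
  simp

lemma prod_powerset_singleton {M : Type*} [CommMonoid M] (g : ℕ → M) :
    ∏ I ∈ ({1} : Finset ℕ).powerset, g I.card = g 0 * g 1 := by
  rw [show ({1} : Finset ℕ).powerset = {∅, {1}} from rfl, Finset.prod_pair (by decide)]
  simp

end AbsZeta

theorem mainTheorem4 :
    -- the explicit zeta functions (M type, F type)
    (∀ u : ℂ,
      ((u ^ 2 - 1) ^ 2 * (u ^ 3 - 1) ^ 2 ≠ 0 →
        walkZeta 3 groverCoinM u =
          ((-((u - 1) / ((u ^ 2 - 1) ^ 2 * (u ^ 3 - 1) ^ 2)) : ℂ) : OnePoint ℂ)) ∧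
      ((u ^ 2 - 1) ^ 2 * (u ^ 3 - 1) ^ 2 = 0 → walkZeta 3 groverCoinM u = OnePoint.infty)) ∧
    (∀ u : ℂ,
      ((u ^ 2 - 1) * (u ^ 4 - 1) ^ 2 ≠ 0 →
        walkZeta 3 groverCoinF u =
          (((u - 1) / ((u ^ 2 - 1) * (u ^ 4 - 1) ^ 2) : ℂ) : OnePoint ℂ)) ∧
      ((u ^ 2 - 1) * (u ^ 4 - 1) ^ 2 = 0 → walkZeta 3 groverCoinF u = OnePoint.infty)) ∧
    -- absolute automorphy
    IsAbsoluteAutomorphicForm groverZetaM (-9) ∧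
    IsAbsoluteAutomorphicForm groverZetaF (-9) ∧
    -- the multiple Hurwitz zeta functions have meromorphic continuations, regular at `0`
    (∀ x : ℂ, ¬ IsGammaPole ![2, 2, 3, 3] x →
      IsContinuationFrom 4 (MultHurwitzConverges ![2, 2, 3, 3] x)
        (multHurwitzSeries ![2, 2, 3, 3] x) (fun w => multHurwitz w x ![2, 2, 3, 3]) ∧
      AnalyticAt ℂ (fun w => multHurwitz w x ![2, 2, 3, 3]) 0) ∧
    (∀ x : ℂ, ¬ IsGammaPole ![2, 4, 4] x →
      IsContinuationFrom 3 (MultHurwitzConverges ![2, 4, 4] x)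
        (multHurwitzSeries ![2, 4, 4] x) (fun w => multHurwitz w x ![2, 4, 4]) ∧
      AnalyticAt ℂ (fun w => multHurwitz w x ![2, 4, 4]) 0) ∧
    -- M type: the absolute Hurwitz zeta function
    (∀ s : ℂ, -9 < s.re →
      IsContinuationFrom 3 (AbsHurwitzConverges groverZetaM s) (absHurwitzIntegral groverZetaM s)
        (fun w => absHurwitz groverZetaM w s) ∧
      AnalyticAt ℂ (fun w => absHurwitz groverZetaM w s) 0 ∧
      ∀ w : ℂ, w ≠ 1 → w ≠ 2 → w ≠ 3 → w ≠ 4 →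
        absHurwitz groverZetaM w s =
          -∑ I ∈ ({1} : Finset ℕ).powerset,
            (-1 : ℂ) ^ I.card * multHurwitz w (s + 9 + (I.card : ℂ)) ![2, 2, 3, 3]) ∧
    -- M type: the absolute zeta function
    IsContinuationFrom (-9) (AbsZetaDefined groverZetaM) (absZetaExp groverZetaM)
      (absZeta groverZetaM) ∧
    (∀ s : ℂ, ¬ IsGammaPole ![2, 2, 3, 3] (s + 9) → ¬ IsGammaPole ![2, 2, 3, 3] (s + 10) →
      absZeta groverZetaM s =
        ∏ I ∈ ({1} : Finset ℕ).powerset,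
          multGamma (s + 9 + (I.card : ℂ)) ![2, 2, 3, 3] ^ ((-1 : ℤ) ^ (I.card + 1))) ∧
    -- M type: the functional equation
    (∀ s : ℂ, ¬ IsGammaPole ![2, 2, 3, 3] (s + 9) → ¬ IsGammaPole ![2, 2, 3, 3] (s + 10) →
      ¬ IsGammaPole ![2, 2, 3, 3] (-s) → ¬ IsGammaPole ![2, 2, 3, 3] (1 - s) →
      (absZeta groverZetaM (-9 - s))⁻¹ =
        (∏ I ∈ ({1} : Finset ℕ).powerset,
          multSine (s + 9 + (I.card : ℂ)) ![2, 2, 3, 3] ^ ((-1 : ℤ) ^ (I.card + 1))) *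
          absZeta groverZetaM s) ∧
    -- F type: the absolute Hurwitz zeta function
    (∀ s : ℂ, -9 < s.re →
      IsContinuationFrom 2 (AbsHurwitzConverges groverZetaF s) (absHurwitzIntegral groverZetaF s)
        (fun w => absHurwitz groverZetaF w s) ∧
      AnalyticAt ℂ (fun w => absHurwitz groverZetaF w s) 0 ∧
      ∀ w : ℂ, w ≠ 1 → w ≠ 2 → w ≠ 3 →
        absHurwitz groverZetaF w s =
          ∑ I ∈ ({1} : Finset ℕ).powerset,
            (-1 : ℂ) ^ I.card * multHurwitz w (s + 9 + (I.card : ℂ)) ![2, 4, 4]) ∧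
    -- F type: the absolute zeta function
    IsContinuationFrom (-9) (AbsZetaDefined groverZetaF) (absZetaExp groverZetaF)
      (absZeta groverZetaF) ∧
    (∀ s : ℂ, ¬ IsGammaPole ![2, 4, 4] (s + 9) → ¬ IsGammaPole ![2, 4, 4] (s + 10) →
      absZeta groverZetaF s =
        ∏ I ∈ ({1} : Finset ℕ).powerset,
          multGamma (s + 9 + (I.card : ℂ)) ![2, 4, 4] ^ ((-1 : ℤ) ^ I.card)) ∧
    -- F type: the functional equation
    (∀ s : ℂ, ¬ IsGammaPole ![2, 4, 4] (s + 9) → ¬ IsGammaPole ![2, 4, 4] (s + 10) →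
      ¬ IsGammaPole ![2, 4, 4] (-s) → ¬ IsGammaPole ![2, 4, 4] (1 - s) →
      absZeta groverZetaF (-9 - s) =
        (∏ I ∈ ({1} : Finset ℕ).powerset,
          multSine (s + 9 + (I.card : ℂ)) ![2, 4, 4] ^ ((-1 : ℤ) ^ I.card)) *
          absZeta groverZetaF s) := by
  have hωM : ∀ i, 0 < (![2, 2, 3, 3] : Fin 4 → ℝ) i := by
    intro i
    fin_cases i <;> norm_num
  have hωF : ∀ i, 0 < (![2, 4, 4] : Fin 3 → ℝ) i := by
    intro i
    fin_cases i <;> norm_num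
  have hZM := absZeta_continuation hωM (fun t ht => groverZetaM_exp ht) hasPoleExpansion_groverM
  have hZF := absZeta_continuation hωF (fun t ht => groverZetaF_exp ht) hasPoleExpansion_groverF
  have e10 : ∀ s : ℂ, s + 9 + 1 = s + 10 := fun s => by ring
  have e0 : ∀ s : ℂ, -9 - s + 9 = -s := fun s => by ring
  have e1 : ∀ s : ℂ, -9 - s + 10 = 1 - s := fun s => by ring
  -- as the periods sum to `10` in both cases, `s + 9` and `s + 10` are reflected to `1 - s` and `-s`
  have hsumM : ∑ i, ((![2, 2, 3, 3] : Fin 4 → ℝ) i : ℂ) = 10 := by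
    simp [Fin.sum_univ_four]
    norm_num
  have hsumF : ∑ i, ((![2, 4, 4] : Fin 3 → ℝ) i : ℂ) = 10 := by
    simp [Fin.sum_univ_three]
    norm_num
  refine ⟨walkZeta_groverCoinM, walkZeta_groverCoinF, isAbsoluteAutomorphicForm_groverZetaM,
    isAbsoluteAutomorphicForm_groverZetaF, fun x hx => ⟨?_, ?_⟩, fun x hx => ⟨?_, ?_⟩,
    fun s hs => ?_, hZM.1, fun s h9 h10 => ?_, fun s h9 h10 h0 h1 => ?_,
    fun s hs => ?_, hZF.1, fun s h9 h10 => ?_, fun s h9 h10 h0 h1 => ?_⟩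
  · exact_mod_cast isContinuationFrom_multHurwitz hωM hx
  · exact analyticAt_multHurwitz hωM hx (polePoly_zero_ne_zero 4)
  · exact_mod_cast isContinuationFrom_multHurwitz hωF hx
  · exact analyticAt_multHurwitz hωF hx (polePoly_zero_ne_zero 3)
  · obtain ⟨h1, h2, h3⟩ := absHurwitz_continuation hωM (fun t ht => groverZetaM_exp ht)
      hasPoleExpansion_groverM hs
    refine ⟨by exact_mod_cast h1, h2, fun w w1 w2 w3 w4 => ?_⟩
    have hp : polePoly 4 w ≠ 0 := by
      refine polePoly_ne_zero fun j hj1 hj4 => ?_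
      interval_cases j <;> assumption_mod_cast
    rw [(h3 w hp).eq_of_nhds, sum_powerset_singleton fun k =>
      (-1 : ℂ) ^ k * multHurwitz w (s + 9 + (k : ℂ)) ![2, 2, 3, 3]]
    simp only [Nat.cast_zero, Nat.cast_one, add_zero, e10]
    push_cast
    ring
  · rw [hZM.2 s h9 h10, prod_powerset_singleton fun k =>
      multGamma (s + 9 + (k : ℂ)) ![2, 2, 3, 3] ^ ((-1 : ℤ) ^ (k + 1))]
    simp only [Nat.cast_zero, Nat.cast_one, add_zero, e10]
    norm_num
    rw [inv_mul_eq_div]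
  · rw [hZM.2 s h9 h10, hZM.2 (-9 - s) (by rwa [e0]) (by rwa [e1]),
      prod_powerset_singleton fun k =>
        multSine (s + 9 + (k : ℂ)) ![2, 2, 3, 3] ^ ((-1 : ℤ) ^ (k + 1)), multSine, multSine, hsumM]
    simp only [Nat.cast_zero, Nat.cast_one, add_zero, e10]
    rw [e0, e1, show 10 - (s + 9) = 1 - s by ring, show 10 - (s + 10) = -s by ring]
    norm_num
    have g1 := multGamma_ne_zero (ω := ![2, 2, 3, 3]) (s + 9)
    have g2 := multGamma_ne_zero (ω := ![2, 2, 3, 3]) (s + 10)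
    have g3 := multGamma_ne_zero (ω := ![2, 2, 3, 3]) (1 - s)
    field_simp
  · obtain ⟨h1, h2, h3⟩ := absHurwitz_continuation hωF (fun t ht => groverZetaF_exp ht)
      hasPoleExpansion_groverF hs
    refine ⟨by exact_mod_cast h1, h2, fun w w1 w2 w3 => ?_⟩
    have hp : polePoly 3 w ≠ 0 := by
      refine polePoly_ne_zero fun j hj1 hj3 => ?_
      interval_cases j <;> assumption_mod_cast
    rw [(h3 w hp).eq_of_nhds, sum_powerset_singleton fun k =>
      (-1 : ℂ) ^ k * multHurwitz w (s + 9 + (k : ℂ)) ![2, 4, 4]]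
    simp only [Nat.cast_zero, Nat.cast_one, add_zero, e10]
    push_cast
    ring
  · rw [hZF.2 s h9 h10, prod_powerset_singleton fun k =>
      multGamma (s + 9 + (k : ℂ)) ![2, 4, 4] ^ ((-1 : ℤ) ^ k)]
    simp only [Nat.cast_zero, Nat.cast_one, add_zero, e10]
    norm_num
    rw [div_eq_mul_inv]
  · rw [hZF.2 s h9 h10, hZF.2 (-9 - s) (by rwa [e0]) (by rwa [e1]),
      prod_powerset_singleton fun k =>
        multSine (s + 9 + (k : ℂ)) ![2, 4, 4] ^ ((-1 : ℤ) ^ k), multSine, multSine, hsumF]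
    simp only [Nat.cast_zero, Nat.cast_one, add_zero, e10]
    rw [e0, e1, show 10 - (s + 9) = 1 - s by ring, show 10 - (s + 10) = -s by ring]
    norm_num
    have g1 := multGamma_ne_zero (ω := ![2, 4, 4]) (s + 9)
    have g2 := multGamma_ne_zero (ω := ![2, 4, 4]) (s + 10)
    have g3 := multGamma_ne_zero (ω := ![2, 4, 4]) (1 - s)
    field_simp
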